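/- **Setting.** Consider $n=n_l+n_f$ agents in $\mathbb R^3$, the leaders $\mathcal V_l=\{1,\dots,n_l\}$ and the followers $\mathcal V_f=\{n_l+1,\dots,n\}$, with dynamics $p_i^{(m)}=u_i$, $m\ge 1$, i.e. $\dot x_i=Ax_i+Bu_i$ for $x_i=(p_i,\dot p_i,\dots,p_i^{(m-1)})\in\mathbb R^{3m}$, where $A=N\otimes I_3$ with $N$ the $m\times m$ matrix with ones on the first superdiagonal and zeros elsewhere, and $B=(0,\dots,0,1)^\top\otimes I_3$. The measured outputs are $y_i=Cx_i\in\mathbb R^q$. *Nominal formation.* Let $\mathcal G=(\mathcal V,\mathcal E)$ be a directed graph without self-loops on the agents, $\mathcal N_i=\{j:(i,j)\in\mathcal E\}$, and let $r_i\in\mathbb R^3$ be nominal positions. For each follower $i$ let weights $w_{ij}$ ($j\in\mathcal N_i$) satisfy $\sum_{j\in\mathcal N_i}w_{ij}(r_i-r_j)=0$ and $\sum_{j\in\mathcal N_i}|w_{ij}|>0$. The follower matrix $\Omega_f=[\Omega_{fl}\ \Omega_{ff}]\in\mathbb R^{n_f\times n}$ has entry $-w_{ij}$ for $j\in\mathcal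 N_i$, entry $0$ for $j\notin\mathcal N_i\cup\{i\}$, and entry $\sum_{k\in\mathcal N_i}w_{ik}$ for $j=i$. Assume that the nominal formation is localizable: $\Omega_{ff}$ is nonsingular. *Desired formation.* $p_i^*(t)=a(t)Q(t)g_i(t)+b(t)$ for $t\ge0$, with scaling $a(t)\in\mathbb R$, rotation $Q(t)\in SO(3)$, translation $b(t)\in\mathbb R^3$ and shape $g(t)=(g_l(t),g_f(t))$ satisfying $(\Omega_{fl}\otimes I_3)g_l(t)+(\Omega_{ff}\otimes I_3)g_f(t)=0$. Put $x_i^*=(p_i^*,\dots,{p_i^*}^{(m-1)})$. Assume that for every leader $p_i^*$ is $m$ times differentiable on $[0,\infty)$ with $\|{p_i^*}^{(k)}(t)\|_2\le\gamma_k$ for $k=1,\dots,m$ and $t\ge 0$. *Controllers.* Each leader uses $\dot\eta_i=A\eta_i+Bu_i+L(C\eta_i-y_i)$, $u_i=(\beta\otimes I_3)^\top(\eta_i-x_i^*)+{p_i^*}^{(m)}$ with $\beta=(\beta_0,\dots,\beta_{m-1})^\top$. Each follower uses $$\dot\eta_i=A\eta_i+Bu_i+L(C\eta_i-y_i)+c_1L\sum_{j=1}^n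 w'_{ij}\,[C(\eta_i-\eta_j)-(y_i-y_j)],$$ $$u_i=c_1K\sum_{j=1}^n w'_{ij}(\eta_i-\eta_j)+c_2\,\mathrm{sgn}\Big[K\sum_{j=1}^n w'_{ij}(\eta_i-\eta_j)\Big],$$ with componentwise signum, where the weights $w'_{ij}$ ($j\ne i$) are the negatives of the entries of either $\bar\Omega_f=\Omega_{ff}^{-1}\Omega_f$ or $\widehat\Omega_f=\Omega_{ff}^\top\Omega_f$ (the same choice for all followers). Solutions of the discontinuous closed-loop system are understood in the sense of Filippov on $[0,\infty)$. *The constant $\gamma_u$.* Let $W_1$ be the $m\times m$ companion matrix with ones on the superdiagonal and last row $(\beta_0,\dots,\beta_{m-1})$, let $W_2$ be the $m\times m$ matrix with the same last row and zeros elsewhere, and $$W=\begin{bmatrix}W_1\otimes I_3&W_2\otimes I_3\\0&A+LC\end{bmatrix}=MJM^{-1}$$ with $J$ a (complex) Jordan form of $W$. Let $\psi$ be either an upper bound of $\|\exp(Jt)\|_2$ over $t>0$, or the number $\sqrt{6m+3m(6m-1)\big(\tfrac{6m-1}{|\lambda_{\max}(W)|\,\exp(1)}\big)^{6m-1}}$,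 where $\lambda_{\max}(W)$ is the largest real part of an eigenvalue of $W$. For $\zeta\in\mathbb R$ put $\gamma_u=4\psi\zeta\|\beta\|_2\|M\|_2\|M^{-1}\|_2+\gamma_m$. **Theorem.** Suppose that 1. $W_1$ is Hurwitz; 2. $K=-B^\top P^{-1}$ with $P>0$ and $AP+PA^\top-2BB^\top<0$; 3. $L=-H^{-1}C^\top$ with $H>0$ and $A^\top H+HA-2C^\top C<0$. Let $\mathcal X_l\subset\mathbb R^{3mn_l}$ be any bounded set of initial leader states, let $\zeta$ satisfy $\|x_i-x_i^*(0)\|_2\le\zeta$ for all $(x_1,\dots,x_{n_l})\in\mathcal X_l$ and $i\in\mathcal V_l$, and suppose that 4. $c_1>\max\{1,1/\lambda_{\min}(\Omega_{ff}^\top\Omega_{ff})\}$, $c_2>0$ and $c_2\ge n_l\,\sigma\,\gamma_u$, where $\sigma$ is the largest absolute value of an entry of $\Omega_{ff}^{-1}\Omega_{fl}$. Then for each of the two follower controllers the multi-agent system achieves semi-global formation maneuver control: every closed-loop trajectory on $[0,\infty)$ with $(x_1(0),\dots,x_{n_l}(0))\in\mathcal X_l$ and $\|\eta_i(0)-x_i(0)\|_2\le\zeta$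 for all $i\in\mathcal V_l$ (and arbitrary initial follower states and estimates) satisfies, as $t\to\infty$, $x_i(t)-x_i^*(t)\to0$ for all leaders and all followers, and $z_f(t)+(\Omega_{ff}^{-1}\Omega_{fl}\otimes I_{6m})z_l(t)\to0$, where $z_i=(x_i,\eta_i)$ and $z_l,z_f$ stack the $z_i$ of the leaders and of the followers. -/

import Mathlib

open Set Filter Topology MeasureTheory
open scoped Kronecker Matrix

noncomputable section

/-! ### Norms, spectra -/

/-- The Euclidean norm of a real vector with coordinates indexed by `ι`. -/
def norm2 {ι : Type*} [Fintype ι] (v : ι → ℝ) : ℝ :=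
  Real.sqrt (∑ i, v i ^ 2)

open scoped Matrix.Norms.L2Operator in
/-- The spectral norm (operator norm for the Euclidean norms) of a complex square matrix. -/
def specNorm {ι : Type*} [Fintype ι] [DecidableEq ι] (M : Matrix ι ι ℂ) : ℝ :=
  ‖M‖

/-- Complexification of a real matrix. -/
def cplx {ι : Type*} (A : Matrix ι ι ℝ) : Matrix ι ι ℂ :=
  A.map Complex.ofReal

/-- All complex eigenvalues have negative real part. -/
def IsHurwitz {ι : Type*} [Fintype ι] [DecidableEq ι] (A : Matrix ι ι ℝ) : Prop :=
  ∀ μ ∈ spectrum ℂ (cplx A), μ.re < 0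

/-- The smallest real eigenvalue (used for symmetric matrices). -/
def lambdaMin {ι : Type*} [Fintype ι] [DecidableEq ι] (A : Matrix ι ι ℝ) : ℝ :=
  sInf (spectrum ℝ A)

/-- The largest real part of an eigenvalue (the largest eigenvalue if all of them are real). -/
def lambdaMax {ι : Type*} [Fintype ι] [DecidableEq ι] (A : Matrix ι ι ℝ) : ℝ :=
  sSup (Complex.re '' spectrum ℂ (cplx A))

/-- The `d × d` Jordan block with eigenvalue `μ`. -/
def jordanBlk (d : ℕ) (μ : ℂ) : Matrix (Fin d) (Fin d) ℂ :=
  Matrix.of fun i j => if i = j then μ else if (i : ℕ) + 1 = (j : ℕ) then 1 else 0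

/-- `J` is block diagonal with Jordan blocks, for some listing of its index set. -/
def IsJordanForm {ι : Type*} (J : Matrix ι ι ℂ) : Prop :=
  ∃ (b : ℕ) (d : Fin b → ℕ) (μ : Fin b → ℂ) (e : (Σ s : Fin b, Fin (d s)) ≃ ι),
    J.submatrix e e = Matrix.blockDiagonal' fun s => jordanBlk (d s) (μ s)

/-! ### Filippov solutions -/

/-- The Filippov regularisation `K[f](x, t)` of a time-dependent vector field. -/
def filippovSet {E : Type*} [NormedAddCommGroup E] [NormedSpace ℝ E] [MeasureSpace E]
    (f : ℝ → E → E) (t : ℝ) (x : E) : Set E :=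
  ⋂ (δ : ℝ) (_ : 0 < δ) (N : Set E) (_ : volume N = 0),
    closure (convexHull ℝ (f t '' (Metric.ball x δ \ N)))

/-- `x` is a Filippov solution of `ẋ = f(t, x)` on `[0, ∞)`. -/
def IsFilippovSolution {E : Type*} [NormedAddCommGroup E] [NormedSpace ℝ E] [MeasureSpace E]
    (f : ℝ → E → E) (x : ℝ → E) : Prop :=
  (∀ T : ℝ, 0 ≤ T → AbsolutelyContinuousOnInterval x 0 T) ∧
    ∀ᵐ t ∂(volume.restrict (Ici (0 : ℝ))), ∃ v ∈ filippovSet f t (x t), HasDerivAt x v t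

/-! ### Nominal formation and follower matrix -/

/-- Agents: `Sum.inl` are the leaders and `Sum.inr` the followers. -/
abbrev Agent (nl nf : ℕ) := Fin nl ⊕ Fin nf

/-- A nominal formation: a directed graph without self-loops on the agents, and nominal
positions in three-dimensional space. -/
structure NominalFormation (nl nf : ℕ) where
  edges : Set (Agent nl nf × Agent nl nf)
  loopless : ∀ i, (i, i) ∉ edges
  r : Agent nl nf → Fin 3 → ℝ

namespace NominalFormation

variable {nl nf : ℕ}

open Classical in
/-- The neighbour set `N_i`. -/
def nbrs (F : NominalFormation nl nf) (i : Agent nl nf) : Finset (Agent nl nf) :=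
  Finset.univ.filter fun j => (i, j) ∈ F.edges

/-- `w i` is a displacement parameter set of the follower `i`, for every follower `i`. -/
def IsDisplacementParam (F : NominalFormation nl nf) (w : Fin nf → Agent nl nf → ℝ) : Prop :=
  ∀ i : Fin nf,
    ∑ j ∈ F.nbrs (Sum.inr i), w i j • (F.r (Sum.inr i) - F.r j) = 0 ∧
    0 < ∑ j ∈ F.nbrs (Sum.inr i), |w i j|

open Classical in
/-- The follower matrix `Ω_f` with edge weights `w`. -/
def followerMatrix (F : NominalFormation nl nf) (w : Fin nf → Agent nl nf → ℝ) :
    Matrix (Fin nf) (Agent nl nf) ℝ :=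
  Matrix.of fun i j =>
    if j = Sum.inr i then ∑ k ∈ F.nbrs (Sum.inr i), w i k
    else if j ∈ F.nbrs (Sum.inr i) then -w i j else 0

end NominalFormation

/-- The leader block `Ω_fl` of a follower matrix. -/
def blockFL {nl nf : ℕ} (Ω : Matrix (Fin nf) (Agent nl nf) ℝ) : Matrix (Fin nf) (Fin nl) ℝ :=
  Ω.submatrix id Sum.inl

/-- The follower block `Ω_ff` of a follower matrix. -/
def blockFF {nl nf : ℕ} (Ω : Matrix (Fin nf) (Agent nl nf) ℝ) : Matrix (Fin nf) (Fin nf) ℝ :=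
  Ω.submatrix id Sum.inr

/-- `Ω_ff` is nonsingular. -/
def IsLocalizable {nl nf : ℕ} (Ω : Matrix (Fin nf) (Agent nl nf) ℝ) : Prop :=
  IsUnit (blockFF Ω).det

/-- The matrix `Ω_ff⁻¹ Ω_fl`. -/
def sigmaMat {nl nf : ℕ} (Ω : Matrix (Fin nf) (Agent nl nf) ℝ) : Matrix (Fin nf) (Fin nl) ℝ :=
  (blockFF Ω)⁻¹ * blockFL Ω

/-- `σ`, the largest absolute value of an entry of `Ω_ff⁻¹ Ω_fl`. -/
def sigmaMax {nl nf : ℕ} (Ω : Matrix (Fin nf) (Agent nl nf) ℝ) : ℝ :=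
  ⨆ ij : Fin nf × Fin nl, |sigmaMat Ω ij.1 ij.2|

/-- The modified follower matrix `Ω_ff⁻¹ Ω_f`. -/
def barMatrix {nl nf : ℕ} (Ω : Matrix (Fin nf) (Agent nl nf) ℝ) :
    Matrix (Fin nf) (Agent nl nf) ℝ :=
  (blockFF Ω)⁻¹ * Ω

/-- The modified follower matrix `Ω_ffᵀ Ω_f`. -/
def hatMatrix {nl nf : ℕ} (Ω : Matrix (Fin nf) (Agent nl nf) ℝ) :
    Matrix (Fin nf) (Agent nl nf) ℝ :=
  (blockFF Ω)ᵀ * Ω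

/-! ### The desired formation -/

/-- Maneuver parameters: scaling `a`, rotation `Q`, translation `b`, shape `g`. -/
structure Maneuver (nl nf : ℕ) where
  a : ℝ → ℝ
  Q : ℝ → Matrix (Fin 3) (Fin 3) ℝ
  b : ℝ → Fin 3 → ℝ
  g : Agent nl nf → ℝ → Fin 3 → ℝ

/-- Coordinates of a motion state: `(k, a)` is coordinate `a` of the `k`-th derivative. -/
abbrev Vec (m : ℕ) := Fin m × Fin 3 → ℝ

namespace Maneuver

variable {nl nf : ℕ}

/-- `Q(t)` is a rotation and `(Ω_fl ⊗ I₃) g_l(t) + (Ω_ff ⊗ I₃) g_f(t) = 0`, at all times. -/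
def IsAdmissible (D : Maneuver nl nf) (Ω : Matrix (Fin nf) (Agent nl nf) ℝ) : Prop :=
  ∀ t : ℝ, 0 ≤ t →
    D.Q t ∈ Matrix.specialOrthogonalGroup (Fin 3) ℝ ∧
    ∀ i : Fin nf,
      ∑ j : Fin nl, blockFL Ω i j • D.g (Sum.inl j) t +
        ∑ j : Fin nf, blockFF Ω i j • D.g (Sum.inr j) t = 0

/-- The desired position `p_i*(t) = a(t) Q(t) g_i(t) + b(t)`. -/
def pos (D : Maneuver nl nf) (i : Agent nl nf) (t : ℝ) : Fin 3 → ℝ :=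
  D.a t • (D.Q t *ᵥ D.g i t) + D.b t

/-- The `k`-th derivative of `p_i*` on `[0, ∞)` (one-sided at `0`). -/
def posDeriv (D : Maneuver nl nf) (i : Agent nl nf) (k : ℕ) (t : ℝ) : Fin 3 → ℝ :=
  iteratedDerivWithin k (D.pos i) (Ici (0 : ℝ)) t

/-- The desired motion state `x_i*(t)`. -/
def state (D : Maneuver nl nf) (m : ℕ) (i : Agent nl nf) (t : ℝ) : Vec m :=
  fun ka => D.posDeriv i ka.1 t ka.2

/-- The desired trajectory of every leader is `m` times differentiable, and its derivatives of
orders `1, …, m` are bounded by `γ 1, …, γ m`. -/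
def HasBoundedDerivs (D : Maneuver nl nf) (m : ℕ) (γ : ℕ → ℝ) : Prop :=
  ∀ i : Fin nl,
    (∀ k < m, DifferentiableOn ℝ (D.posDeriv (Sum.inl i) k) (Ici (0 : ℝ))) ∧
    ∀ k, 1 ≤ k → k ≤ m → ∀ t : ℝ, 0 ≤ t → norm2 (D.posDeriv (Sum.inl i) k t) ≤ γ k

end Maneuver

/-! ### Agent dynamics and controllers -/

/-- The system matrix `A` of the `m`-th order integrator in three dimensions. -/
def matA (m : ℕ) : Matrix (Fin m × Fin 3) (Fin m × Fin 3) ℝ :=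
  (Matrix.of fun i j : Fin m => if (i : ℕ) + 1 = (j : ℕ) then (1 : ℝ) else 0) ⊗ₖ
    (1 : Matrix (Fin 3) (Fin 3) ℝ)

/-- The input matrix `B` of the `m`-th order integrator in three dimensions. -/
def matB (m : ℕ) : Matrix (Fin m × Fin 3) (Fin 3) ℝ :=
  Matrix.of fun ka c => if (ka.1 : ℕ) + 1 = m ∧ ka.2 = c then 1 else 0

/-- The companion matrix `W₁` of the leader gain `β`. -/
def matW1 {m : ℕ} (β : Fin m → ℝ) : Matrix (Fin m) (Fin m) ℝ :=
  Matrix.of fun i j =>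
    if (i : ℕ) + 1 = m then β j else if (i : ℕ) + 1 = (j : ℕ) then 1 else 0

/-- The matrix `W₂`, with last row `β` and all other rows zero. -/
def matW2 {m : ℕ} (β : Fin m → ℝ) : Matrix (Fin m) (Fin m) ℝ :=
  Matrix.of fun i j => if (i : ℕ) + 1 = m then β j else 0

/-- The matrix `W` of the error dynamics of a leader. -/
def matW {m q : ℕ} (β : Fin m → ℝ) (C : Matrix (Fin q) (Fin m × Fin 3) ℝ)
    (L : Matrix (Fin m × Fin 3) (Fin q) ℝ) :
    Matrix ((Fin m × Fin 3) ⊕ (Fin m × Fin 3)) ((Fin m × Fin 3) ⊕ (Fin m × Fin 3)) ℝ :=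
  Matrix.fromBlocks (matW1 β ⊗ₖ (1 : Matrix (Fin 3) (Fin 3) ℝ))
    (matW2 β ⊗ₖ (1 : Matrix (Fin 3) (Fin 3) ℝ)) 0 (matA m + L * C)

/-- The explicit number
`ψ = √(6m + 3m(6m-1) ((6m-1) / (|λ_max(W)| exp 1)) ^ (6m-1))`. -/
def psiExplicit {m q : ℕ} (β : Fin m → ℝ) (C : Matrix (Fin q) (Fin m × Fin 3) ℝ)
    (L : Matrix (Fin m × Fin 3) (Fin q) ℝ) : ℝ :=
  Real.sqrt (6 * m + 3 * m * (6 * m - 1) *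
    ((6 * m - 1) / (|lambdaMax (matW β C L)| * Real.exp 1)) ^ (6 * m - 1 : ℕ))

open scoped Matrix.Norms.L2Operator in
/-- `ψ` bounds the spectral norm of `exp (J t)` for all `t > 0`. -/
def BoundsExp {ι : Type*} [Fintype ι] [DecidableEq ι] (J : Matrix ι ι ℂ) (ψ : ℝ) : Prop :=
  ∀ t : ℝ, 0 < t → specNorm (NormedSpace.exp ((t : ℂ) • J)) ≤ ψ

/-- The number `γ_u = 4 ψ ζ ‖β‖ ‖M‖ ‖M⁻¹‖ + γ_m`. -/
def gammaU {m : ℕ} {ι : Type*} [Fintype ι] [DecidableEq ι] (ψ ζ : ℝ) (β : Fin m → ℝ)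
    (M : Matrix ι ι ℂ) (γm : ℝ) : ℝ :=
  4 * ψ * ζ * norm2 β * specNorm M * specNorm M⁻¹ + γm

/-- A state of the network: the pair `(x_i, η_i)` of motion state and estimate, for each
agent `i`. -/
abbrev NetState (nl nf m : ℕ) := Agent nl nf → Vec m × Vec m

/-- The componentwise signum of a vector. -/
def sgnVec (v : Fin 3 → ℝ) : Fin 3 → ℝ := fun c => Real.sign (v c)

section ClosedLoop

variable {nl nf m q : ℕ}

/-- Control input of leader `i`: `(β ⊗ I₃)ᵀ (η_i - x_i*) + p_i*⁽ᵐ⁾`. -/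
def leaderInput (D : Maneuver nl nf) (β : Fin m → ℝ) (t : ℝ) (z : NetState nl nf m)
    (i : Fin nl) : Fin 3 → ℝ :=
  fun c => ∑ k : Fin m, β k * ((z (Sum.inl i)).2 (k, c) - D.state m (Sum.inl i) t (k, c)) +
    D.posDeriv (Sum.inl i) m t c

/-- Edge weight `w_ij = -Ψ_ij` read off a follower matrix `Ψ`. The value at `j = i` is
immaterial, since it only ever multiplies a difference that vanishes for `j = i`. -/
def edgeWeight (Ψ : Matrix (Fin nf) (Agent nl nf) ℝ) (i : Fin nf) (j : Agent nl nf) : ℝ :=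
  -Ψ i j

/-- Control input of follower `i`:
`c₁ K ∑ⱼ w_ij (η_i - η_j) + c₂ sgn (K ∑ⱼ w_ij (η_i - η_j))`. -/
def followerInput (Ψ : Matrix (Fin nf) (Agent nl nf) ℝ) (K : Matrix (Fin 3) (Fin m × Fin 3) ℝ)
    (c₁ c₂ : ℝ) (z : NetState nl nf m) (i : Fin nf) : Fin 3 → ℝ :=
  let s : Fin 3 → ℝ := K *ᵥ ∑ j, edgeWeight Ψ i j • ((z (Sum.inr i)).2 - (z j).2)
  c₁ • s + c₂ • sgnVec s

/-- The closed-loop vector field: every agent obeys `ẋ_i = A x_i + B u_i`, with measured output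
`y_i = C x_i`; the leaders run
`η̇_i = A η_i + B u_i + L (C η_i - y_i)`, the followers
`η̇_i = A η_i + B u_i + L (C η_i - y_i) + c₁ L ∑ⱼ w_ij (C (η_i - η_j) - (y_i - y_j))`. -/
def closedLoop (D : Maneuver nl nf) (Ψ : Matrix (Fin nf) (Agent nl nf) ℝ)
    (C : Matrix (Fin q) (Fin m × Fin 3) ℝ) (β : Fin m → ℝ)
    (K : Matrix (Fin 3) (Fin m × Fin 3) ℝ) (L : Matrix (Fin m × Fin 3) (Fin q) ℝ)
    (c₁ c₂ : ℝ) (t : ℝ) (z : NetState nl nf m) : NetState nl nf m :=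
  let x : Agent nl nf → Vec m := fun i => (z i).1
  let η : Agent nl nf → Vec m := fun i => (z i).2
  let y : Agent nl nf → Fin q → ℝ := fun i => C *ᵥ x i
  let ul : Fin nl → Fin 3 → ℝ := leaderInput D β t z
  let uf : Fin nf → Fin 3 → ℝ := followerInput Ψ K c₁ c₂ z
  Sum.elim
    (fun i : Fin nl =>
      (matA m *ᵥ x (Sum.inl i) + matB m *ᵥ ul i,
        matA m *ᵥ η (Sum.inl i) + matB m *ᵥ ul i +
          L *ᵥ (C *ᵥ η (Sum.inl i) - y (Sum.inl i))))
    (fun i : Fin nf =>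
      (matA m *ᵥ x (Sum.inr i) + matB m *ᵥ uf i,
        matA m *ᵥ η (Sum.inr i) + matB m *ᵥ uf i +
          L *ᵥ (C *ᵥ η (Sum.inr i) - y (Sum.inr i)) +
          c₁ • (L *ᵥ ∑ j, edgeWeight Ψ i j •
            (C *ᵥ (η (Sum.inr i) - η j) - (y (Sum.inr i) - y j)))))

end ClosedLoop

end

/-! The closed loop is a cascade, and each stage is stable with a forcing term that vanishes because
of the stages before it. Both follower matrices have zero row sums and a follower block `S = Rᵀ R`,
and they act on any family `a` only through the combinations `a_i + ∑ⱼ σ_ij a_j` with `σ = Ω_ff⁻¹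
Ω_fl` (`FactorsThrough`, `follErr`).

Estimation errors `η - x`: plant and observer share the same input, so the signum cancels. The
leader errors and the follower combinations of errors decay by the Lyapunov function of `H`; the
coupling through `c₁ S` only helps, since `S` is positive semidefinite (`observer_lyapunov`).

Leaders: axis by axis, the tracking error obeys the Hurwitz system `W₁` forced by the estimation
error (`LocAC.tendsto_zero_of_isHurwitz`).

Follower estimates: with `δ` the combination of estimates and `ρ = R δ`, the function `∑ ρ_i · P⁻¹
ρ_i` is used. Since `K = -Bᵀ P⁻¹`, its gradient pairs with the input channel through `s = K S δ`,
which is exactly the argument of the signum (`sum_gradient_dot_input`). Two things follow. The jump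
of the signum is multiplied by a factor vanishing there, so the Lyapunov derivative has one value on
the whole Filippov set (`continuousAt_lyapGradient_closedLoop`). And the signum term dominates the
leader feedforward `p*⁽ᵐ⁾` as soon as `c₂` exceeds its weighted size; the feedback part of the
leader inputs tends to zero and joins the perturbation (`controller_lyapunov`,
`tendsto_follErr_estimates`).

The desired motion satisfies the same relation between followers and leaders
(`Maneuver.posDeriv_follower`), so vanishing combinations together with leader tracking give
follower tracking. -/

/-! ### Locally absolutely continuous functions and differential inequalities. -/

/-- Absolute continuity on every interval `[0, T]`. -/
def LocAC {X : Type*} [PseudoMetricSpace X] (f : ℝ → X) : Prop :=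
  ∀ T : ℝ, 0 ≤ T → AbsolutelyContinuousOnInterval f 0 T

namespace LocAC

theorem lipschitz_comp {X Y : Type*} [PseudoMetricSpace X] [PseudoMetricSpace Y] {f : ℝ → X}
    (hf : LocAC f) {g : X → Y} {K : NNReal} (hg : LipschitzWith K g) :
    LocAC (fun t => g (f t)) := by
  intro T hT
  have h := (hf T hT)
  unfold AbsolutelyContinuousOnInterval at h ⊢
  refine squeeze_zero (fun E => Finset.sum_nonneg fun _ _ => dist_nonneg) (fun E => ?_)
    (by simpa using h.const_mul (K : ℝ))
  rw [Finset.mul_sum]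
  exact Finset.sum_le_sum fun i _ => hg.dist_le_mul _ _

theorem clm_comp {E F : Type*} [NormedAddCommGroup E] [NormedSpace ℝ E] [NormedAddCommGroup F]
    [NormedSpace ℝ F] {f : ℝ → E} (hf : LocAC f) (φ : E →L[ℝ] F) : LocAC (fun t => φ (f t)) :=
  hf.lipschitz_comp φ.lipschitz

theorem mul {f g : ℝ → ℝ} (hf : LocAC f) (hg : LocAC g) : LocAC (fun t => f t * g t) :=
  fun T hT => (hf T hT).fun_mul (hg T hT)

theorem add {E : Type*} [SeminormedAddCommGroup E] {f g : ℝ → E} (hf : LocAC f) (hg : LocAC g) :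
    LocAC (fun t => f t + g t) :=
  fun T hT => (hf T hT).fun_add (hg T hT)

theorem sub {E : Type*} [SeminormedAddCommGroup E] {f g : ℝ → E} (hf : LocAC f) (hg : LocAC g) :
    LocAC (fun t => f t - g t) :=
  fun T hT => (hf T hT).fun_sub (hg T hT)

theorem const {X : Type*} [PseudoMetricSpace X] (c : X) : LocAC (fun _ => c) := by
  intro T _
  exact (LipschitzWith.const c).lipschitzOnWith.absolutelyContinuousOnInterval

theorem const_mul {f : ℝ → ℝ} (c : ℝ) (hf : LocAC f) : LocAC (fun t => c * f t) :=
  (const c).mul hf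

theorem sum {ι E : Type*} [SeminormedAddCommGroup E] (s : Finset ι) {f : ι → ℝ → E}
    (hf : ∀ i ∈ s, LocAC (f i)) : LocAC (fun t => ∑ i ∈ s, f i t) := by
  classical
  induction s using Finset.induction_on with
  | empty => simpa using const (0 : E)
  | insert a s ha ih =>
    simp only [Finset.sum_insert ha]
    exact (hf a (by simp)).add (ih fun i hi => hf i (by simp [hi]))

/-- A vector-valued function is absolutely continuous if its coordinates are. -/
theorem pi {ι E : Type*} [Fintype ι] [NormedAddCommGroup E] [NormedSpace ℝ E] {f : ℝ → ι → E}
    (hf : ∀ i, LocAC (fun t => f t i)) : LocAC f := by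
  classical
  have : f = fun t => ∑ i, ContinuousLinearMap.single ℝ (fun _ : ι => E) i (f t i) := by
    funext t
    ext j
    simp [Finset.sum_apply, Pi.single_apply]
  rw [this]
  exact sum _ fun i _ => (hf i).clm_comp _

theorem apply {ι E : Type*} [Fintype ι] [NormedAddCommGroup E] [NormedSpace ℝ E] {f : ℝ → ι → E}
    (hf : LocAC f) (i : ι) : LocAC (fun t => f t i) :=
  hf.clm_comp (ContinuousLinearMap.proj (R := ℝ) (φ := fun _ : ι => E) i)

/-- Absolute continuity is what turns an almost-everywhere sign of the derivative into monotonicity,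
by the fundamental theorem of calculus. -/
theorem le_of_deriv_nonpos {w : ℝ → ℝ} (hw : LocAC w)
    {a b : ℝ} (ha : 0 ≤ a) (hab : a ≤ b)
    (hd : ∀ᵐ t ∂(volume.restrict (Ici (0 : ℝ))), a ≤ t → ∃ d, HasDerivAt w d t ∧ d ≤ 0) :
    w b ≤ w a := by
  have hac : AbsolutelyContinuousOnInterval w a b :=
    (hw b (ha.trans hab)).mono (by
      rw [uIcc_of_le hab, uIcc_of_le (ha.trans hab)]; exact Icc_subset_Icc_left ha)
  have h := hac.integral_deriv_eq_sub
  have h2 : ∫ t in a..b, deriv w t ≤ 0 := by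
    have : 0 ≤ ∫ t in a..b, -deriv w t := by
      apply intervalIntegral.integral_nonneg_of_ae_restrict hab
      rw [ae_restrict_iff' measurableSet_Ici] at hd
      filter_upwards [ae_restrict_of_ae hd, ae_restrict_mem measurableSet_Icc] with t ht htm
      obtain ⟨d, h1, h2⟩ := ht (ha.trans htm.1) htm.1
      simp [h1.deriv, h2]
    simpa using this
  linarith

/-- A nonnegative function obeying `v' ≤ -α v + g` with `g → 0` tends to zero. -/
theorem tendsto_zero_of_deriv_le {v g : ℝ → ℝ} {α : ℝ} (hα : 0 < α) (hv : LocAC v)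
    (h0 : ∀ t, 0 ≤ v t)
    (hd : ∀ᵐ t ∂(volume.restrict (Ici (0 : ℝ))), ∃ d, HasDerivAt v d t ∧ d ≤ -α * v t + g t)
    (hg : Tendsto g atTop (𝓝 0)) : Tendsto v atTop (𝓝 0) := by
  have key : ∀ ε > 0, ∀ᶠ t in atTop, v t < ε := by
    intro ε hε
    -- Once `g < α ε / 2`, the inequality reads `(v - ε/2)' ≤ -α (v - ε/2)`, so `exp (α t) (v -
    -- ε/2)` no longer increases.
    have hε' : 0 < α * (ε / 2) := by positivity
    obtain ⟨T, hT⟩ := eventually_atTop.1 (hg.eventually (gt_mem_nhds hε'))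
    set T₀ := max T 0 with hT₀
    have hexp : LocAC (fun t => Real.exp (α * t)) := by
      intro S hS
      apply ContDiffOn.absolutelyContinuousOnInterval
      fun_prop
    have hw : LocAC (fun t => Real.exp (α * t) * (v t - ε / 2)) :=
      hexp.mul (hv.sub (const _))
    have hle : ∀ t, T₀ ≤ t →
        Real.exp (α * t) * (v t - ε / 2) ≤ Real.exp (α * T₀) * (v T₀ - ε / 2) := by
      intro t ht
      refine hw.le_of_deriv_nonpos (le_max_right _ _) ht ?_
      filter_upwards [hd] with s ⟨d, hd1, hd2⟩ hs
      refine ⟨_, ((((hasDerivAt_id s).const_mul α).exp).mul (hd1.sub_const _)), ?_⟩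
      have := hT s ((le_max_left _ _).trans hs)
      have he := Real.exp_pos (α * s)
      simp only [id, mul_one]
      nlinarith
    have hlim : Tendsto (fun t => Real.exp (-(α * t)) *
        (Real.exp (α * T₀) * (v T₀ - ε / 2))) atTop (𝓝 0) := by
      have : Tendsto (fun t => Real.exp (-(α * t))) atTop (𝓝 0) :=
        Real.tendsto_exp_neg_atTop_nhds_zero.comp (tendsto_id.const_mul_atTop hα)
      simpa using this.mul_const (Real.exp (α * T₀) * (v T₀ - ε / 2))
    filter_upwards [hlim.eventually (gt_mem_nhds (half_pos hε)), eventually_ge_atTop T₀]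
      with t h1 h2
    have h3 := mul_le_mul_of_nonneg_left (hle t h2) (Real.exp_pos (-(α * t))).le
    rw [← mul_assoc, ← Real.exp_add, neg_add_cancel, Real.exp_zero, one_mul] at h3
    linarith
  rw [Metric.tendsto_nhds]
  intro ε hε
  filter_upwards [key ε hε] with t ht
  rwa [Real.dist_eq, sub_zero, abs_of_nonneg (h0 t)]

end LocAC

/-! ### Quadratic forms -/

section Quadratic

variable {ι κ : Type*} [Fintype ι] [Fintype κ]

/-- The constant is the minimum of the form on the compact unit sphere, extended by homogeneity; the
sphere is empty only in the trivial space. -/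
theorem posDef_lower {Q : Matrix κ κ ℝ} (hQ : Q.PosDef) :
    ∃ α > 0, ∀ x : κ → ℝ, α * ‖x‖ ^ 2 ≤ x ⬝ᵥ Q *ᵥ x := by
  have hcont : Continuous fun x : κ → ℝ => x ⬝ᵥ Q *ᵥ x := by fun_prop
  rcases (Metric.sphere (0 : κ → ℝ) 1).eq_empty_or_nonempty with he | hne
  · refine ⟨1, one_pos, fun x => ?_⟩
    have hx : x = 0 := by
      by_contra hx
      have : (‖x‖⁻¹ • x) ∈ Metric.sphere (0 : κ → ℝ) 1 := by
        simp [norm_smul, norm_ne_zero_iff.2 hx]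
      simp [he] at this
    simp [hx]
  · obtain ⟨x₀, hx₀, hmin⟩ := (isCompact_sphere (0 : κ → ℝ) 1).exists_isMinOn hne
      hcont.continuousOn
    have hx₀' : x₀ ≠ 0 := by
      rintro rfl
      simp at hx₀
    refine ⟨x₀ ⬝ᵥ Q *ᵥ x₀, by simpa using hQ.dotProduct_mulVec_pos hx₀', fun x => ?_⟩
    rcases eq_or_ne x 0 with rfl | hx
    · simp
    have hn : ‖x‖ ≠ 0 := norm_ne_zero_iff.2 hx
    have h1 : (‖x‖⁻¹ • x) ∈ Metric.sphere (0 : κ → ℝ) 1 := by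
      simp [norm_smul, hn]
    have h2 := hmin h1
    simp only [mem_ofPred_eq, Matrix.mulVec_smul, smul_dotProduct, dotProduct_smul,
      smul_eq_mul] at h2
    have h3 := mul_le_mul_of_nonneg_right h2 (sq_nonneg ‖x‖)
    calc _ ≤ _ := h3
      _ = x ⬝ᵥ Q *ᵥ x := by field_simp

/-- The sup norm of the family is attained at one member, and the other summands are nonnegative. -/
theorem posDef_lower_sum {Q : Matrix κ κ ℝ} (hQ : Q.PosDef) :
    ∃ α > 0, ∀ y : ι → κ → ℝ, α * ‖y‖ ^ 2 ≤ ∑ i, y i ⬝ᵥ Q *ᵥ y i := by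
  obtain ⟨α, hα, h⟩ := posDef_lower hQ
  refine ⟨α, hα, fun y => ?_⟩
  have hnn : ∀ i, 0 ≤ y i ⬝ᵥ Q *ᵥ y i := fun i => (by positivity : 0 ≤ α * ‖y i‖ ^ 2).trans (h _)
  rcases isEmpty_or_nonempty ι with he | hne
  · simp [Subsingleton.elim y 0]
  · obtain ⟨i, hi⟩ := Finite.exists_max fun i => ‖y i‖
    have hle : ‖y‖ ≤ ‖y i‖ := (pi_norm_le_iff_of_nonneg (norm_nonneg _)).2 hi
    calc α * ‖y‖ ^ 2 ≤ α * ‖y i‖ ^ 2 := by gcongr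
      _ ≤ _ := (h _).trans (Finset.single_le_sum (f := fun i => y i ⬝ᵥ Q *ᵥ y i)
      (fun i _ => hnn i) (Finset.mem_univ i))

theorem sum_dot_mulVec_le (P : Matrix κ κ ℝ) :
    ∃ c > 0, ∀ y h : ι → κ → ℝ, ∑ i, y i ⬝ᵥ P *ᵥ h i ≤ c * ‖y‖ * ‖h‖ := by
  -- The `+ 1` only keeps the constant positive when the sum is zero.
  refine ⟨∑ _i : ι, ∑ a, ∑ b, |P a b| + 1, by positivity, fun y h => ?_⟩
  have : ∑ i, y i ⬝ᵥ P *ᵥ h i ≤ ∑ _i : ι, ∑ a, ∑ b, |P a b| * (‖y‖ * ‖h‖) := by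
    refine Finset.sum_le_sum fun i _ => ?_
    simp only [dotProduct, Matrix.mulVec, Finset.mul_sum]
    refine Finset.sum_le_sum fun a _ => Finset.sum_le_sum fun b _ => ?_
    calc y i a * (P a b * h i b) ≤ |y i a * (P a b * h i b)| := le_abs_self _
      _ = |P a b| * (|y i a| * |h i b|) := by rw [abs_mul, abs_mul]; ring
      _ ≤ _ := by
        gcongr
        · exact (norm_le_pi_norm (y i) a).trans (norm_le_pi_norm y i)
        · exact (norm_le_pi_norm (h i) b).trans (norm_le_pi_norm h i)
  refine this.trans ?_
  simp only [← Finset.sum_mul]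
  nlinarith [mul_nonneg (norm_nonneg y) (norm_nonneg h)]

theorem hasDerivAt_sum_quadratic {P : Matrix κ κ ℝ} (hP : P.IsHermitian) {y : ℝ → ι → κ → ℝ}
    {v : ι → κ → ℝ} {t : ℝ} (hy : HasDerivAt y v t) :
    HasDerivAt (fun t => ∑ i, y t i ⬝ᵥ P *ᵥ y t i) (2 * ∑ i, y t i ⬝ᵥ P *ᵥ v i) t := by
  have hia : ∀ i a, HasDerivAt (fun t => y t i a) (v i a) t := fun i a =>
    hasDerivAt_pi.1 (hasDerivAt_pi.1 hy i) a
  rw [Finset.mul_sum]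
  refine HasDerivAt.fun_sum fun i _ => ?_
  have hs : v i ⬝ᵥ P *ᵥ y t i = y t i ⬝ᵥ P *ᵥ v i := by
    have hT : Pᵀ = P := by simpa [Matrix.IsHermitian, Matrix.conjTranspose_eq_transpose_of_trivial] using hP.eq
    rw [Matrix.dotProduct_mulVec, ← Matrix.mulVec_transpose, hT, dotProduct_comm]
  have : HasDerivAt (fun t => y t i ⬝ᵥ P *ᵥ y t i)
      (v i ⬝ᵥ P *ᵥ y t i + y t i ⬝ᵥ P *ᵥ v i) t := by
    simp only [dotProduct, Matrix.mulVec]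
    rw [← Finset.sum_add_distrib]
    refine HasDerivAt.fun_sum fun a _ => (hia i a).mul ?_
    exact HasDerivAt.fun_sum fun b _ => (hia i b).const_mul _
  rwa [hs, ← two_mul] at this

/-- Lyapunov estimate with a vanishing perturbation. -/
theorem LocAC.tendsto_zero_of_energy {P : Matrix κ κ ℝ} (hP : P.PosDef) {y h : ℝ → ι → κ → ℝ}
    (hy : LocAC y) {α : ℝ} (hα : 0 < α) (hh : Tendsto h atTop (𝓝 0))
    (hd : ∀ᵐ t ∂(volume.restrict (Ici (0 : ℝ))), ∃ v, HasDerivAt y v t ∧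
      2 * ∑ i, y t i ⬝ᵥ P *ᵥ v i ≤ -α * ‖y t‖ ^ 2 + 2 * ∑ i, y t i ⬝ᵥ P *ᵥ h t i) :
    Tendsto y atTop (𝓝 0) := by
  obtain ⟨c, hc, hcb⟩ := sum_dot_mulVec_le (ι := ι) P
  obtain ⟨l, hl, hlb⟩ := posDef_lower_sum (ι := ι) hP
  set V : ℝ → ℝ := fun t => ∑ i, y t i ⬝ᵥ P *ᵥ y t i with hV
  have hVac : LocAC V := by
    refine LocAC.sum _ fun i _ => ?_
    simp only [dotProduct, Matrix.mulVec]
    exact LocAC.sum _ fun a _ => ((hy.apply i).apply a).mul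
      (LocAC.sum _ fun b _ => ((hy.apply i).apply b).const_mul _)
  have hV0 : ∀ t, 0 ≤ V t := fun t => (by positivity : 0 ≤ l * ‖y t‖ ^ 2).trans (hlb _)
  have hVlim : Tendsto V atTop (𝓝 0) := by
    -- Half of `α ‖y‖²` yields the decay rate, through `V ≤ c ‖y‖²`; the other half absorbs the
    -- cross term by Young's inequality and leaves `2 c² / α ‖h‖²`.
    refine hVac.tendsto_zero_of_deriv_le (α := α / (2 * c))
      (g := fun t => 2 * c ^ 2 / α * ‖h t‖ ^ 2) (by positivity) hV0 ?_ ?_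
    · filter_upwards [hd] with t ⟨v, hv, hle⟩
      refine ⟨_, hasDerivAt_sum_quadratic hP.isHermitian hv, hle.trans ?_⟩
      have h1 := hcb (y t) (h t)
      have h2 := hcb (y t) (y t)
      have h3 : α / (2 * c) * V t ≤ α / 2 * ‖y t‖ ^ 2 := by
        calc α / (2 * c) * V t ≤ α / (2 * c) * (c * ‖y t‖ * ‖y t‖) := by gcongr
          _ = _ := by field_simp
      have h4 : 2 * (c * ‖y t‖ * ‖h t‖) ≤ α / 2 * ‖y t‖ ^ 2 + 2 * c ^ 2 / α * ‖h t‖ ^ 2 := by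
        have : 0 ≤ α / 2 * (‖y t‖ - 2 * c / α * ‖h t‖) ^ 2 := by positivity
        have e : α / 2 * (‖y t‖ - 2 * c / α * ‖h t‖) ^ 2 = α / 2 * ‖y t‖ ^ 2
          - 2 * (c * ‖y t‖ * ‖h t‖) + 2 * c ^ 2 / α * ‖h t‖ ^ 2 := by field_simp; ring
        linarith
      linarith
    · simpa using ((hh.norm.pow 2).const_mul (2 * c ^ 2 / α))
  rw [tendsto_zero_iff_norm_tendsto_zero]
  have : Tendsto (fun t => Real.sqrt (V t / l)) atTop (𝓝 0) := by
    simpa [Function.comp_def] using (Real.continuous_sqrt.tendsto _).comp (hVlim.div_const l)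
  refine squeeze_zero (fun _ => norm_nonneg _) (fun t => ?_) this
  refine Real.le_sqrt_of_sq_le ?_
  rw [le_div_iff₀ hl, mul_comm]
  exact hlb _

end Quadratic

/-! ### Stable linear equations with vanishing forcing -/

theorem hasDerivAt_re {y : ℝ → ℂ} {v : ℂ} {t : ℝ} (h : HasDerivAt y v t) :
    HasDerivAt (fun s => (y s).re) v.re t :=
  Complex.reCLM.hasFDerivAt.comp_hasDerivAt t h

theorem hasDerivAt_im {y : ℝ → ℂ} {v : ℂ} {t : ℝ} (h : HasDerivAt y v t) :
    HasDerivAt (fun s => (y s).im) v.im t :=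
  Complex.imCLM.hasFDerivAt.comp_hasDerivAt t h

/-- The derivative of `|y|²` is `2 Re μ |y|²` plus a cross term, which Young's inequality bounds by
`|Re μ| |y|² + |h|² / |Re μ|`. -/
theorem LocAC.tendsto_zero_of_scalar_ode {y h : ℝ → ℂ} {μ : ℂ} (hμ : μ.re < 0) (hy : LocAC y)
    (hd : ∀ᵐ t ∂(volume.restrict (Ici (0 : ℝ))), HasDerivAt y (μ * y t + h t) t)
    (hh : Tendsto h atTop (𝓝 0)) : Tendsto y atTop (𝓝 0) := by
  have hre : LocAC fun t => (y t).re := hy.clm_comp Complex.reCLM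
  have him : LocAC fun t => (y t).im := hy.clm_comp Complex.imCLM
  have hV : Tendsto (fun t => (y t).re * (y t).re + (y t).im * (y t).im) atTop (𝓝 0) := by
    refine ((hre.mul hre).add (him.mul him)).tendsto_zero_of_deriv_le (α := -μ.re)
      (g := fun t => ‖h t‖ ^ 2 / (-μ.re)) (by linarith) (fun t => add_nonneg (mul_self_nonneg _) (mul_self_nonneg _)) ?_
      (by simpa using (hh.norm.pow 2).div_const (-μ.re))
    filter_upwards [hd] with t ht
    have h1 := hasDerivAt_re ht
    have h2 := hasDerivAt_im ht
    refine ⟨_, (h1.mul h1).add (h2.mul h2), ?_⟩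
    rw [← Complex.normSq_eq_norm_sq, Complex.normSq_apply]
    simp only [Complex.add_re, Complex.add_im, Complex.mul_re, Complex.mul_im]
    set a := -μ.re with ha
    have ha' : 0 < a := by linarith
    have hμa : μ.re = -a := by rw [ha]; ring
    rw [hμa, ← sub_nonneg]
    -- The slack in the inequality is a sum of squares.
    have e : ∀ u v p q b : ℝ, -a * (u * u + v * v) + (p * p + q * q) / a -
        (((-a * u - b * v + p) * u + u * (-a * u - b * v + p)) +
        ((-a * v + b * u + q) * v + v * (-a * v + b * u + q))) =
        a * ((u - p / a) ^ 2 + (v - q / a) ^ 2) := by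
      intro u v p q b
      field_simp
      ring
    rw [e]
    positivity
  rw [tendsto_zero_iff_norm_tendsto_zero]
  have h3 : (fun t => ‖y t‖) = fun t => √((y t).re * (y t).re + (y t).im * (y t).im) := by
    funext t
    rw [Complex.norm_def, Complex.normSq_apply]
  rw [h3]
  simpa [Function.comp_def] using (Real.continuous_sqrt.tendsto _).comp hV

theorem hasDerivAt_mulVec {ι : Type*} [Fintype ι] (A : Matrix ι ι ℂ) {y : ℝ → ι → ℂ} {v : ι → ℂ}
    {t : ℝ} (hy : HasDerivAt y v t) : HasDerivAt (fun s => A *ᵥ y s) (A *ᵥ v) t := by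
  rw [hasDerivAt_pi]
  intro i
  simp only [Matrix.mulVec, dotProduct]
  exact HasDerivAt.fun_sum fun j _ => (hasDerivAt_pi.1 hy j).const_mul _

theorem LocAC.mulVec {ι : Type*} [Fintype ι] (A : Matrix ι ι ℂ) {y : ℝ → ι → ℂ}
    (hy : LocAC y) : LocAC fun s => A *ᵥ y s :=
  hy.clm_comp (LinearMap.toContinuousLinearMap ((Matrix.mulVecLin A).restrictScalars ℝ))

/-- Roots are peeled off one at a time, in place of a matrix exponential. For `B = A - μ`, the
function `B y` solves the same kind of equation and is annihilated by the remaining factors, hence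
tends to zero; then each coordinate of `y` solves a scalar equation with rate `μ` and vanishing
forcing. -/
theorem LocAC.tendsto_zero_of_roots {ι : Type*} [Fintype ι] [DecidableEq ι] (A : Matrix ι ι ℂ)
    (s : Multiset ℂ) (hs : ∀ μ ∈ s, μ.re < 0) {y h : ℝ → ι → ℂ} (hy : LocAC y)
    (hd : ∀ᵐ t ∂(volume.restrict (Ici (0 : ℝ))), HasDerivAt y (A *ᵥ y t + h t) t)
    (hh : Tendsto h atTop (𝓝 0))
    (h0 : ∀ t, Polynomial.aeval A (s.map fun μ => Polynomial.X - Polynomial.C μ).prod *ᵥ y t = 0) :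
    Tendsto y atTop (𝓝 0) := by
  induction s using Multiset.induction_on generalizing y h with
  | empty =>
    have : y = fun _ => 0 := funext fun t => by simpa using h0 t
    rw [this]
    exact tendsto_const_nhds
  | cons μ s ih =>
    set B : Matrix ι ι ℂ := A - μ • 1 with hB
    have hBA : B * A = A * B := by simp [hB, sub_mul, mul_sub]
    have h1 : Tendsto (fun t => B *ᵥ y t) atTop (𝓝 0) := by
      refine ih (fun ν hν => hs ν (Multiset.mem_cons_of_mem hν)) (h := fun t => B *ᵥ h t)
        (hy.mulVec B) ?_ ?_ ?_
      · filter_upwards [hd] with t ht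
        convert hasDerivAt_mulVec B ht using 1
        rw [Matrix.mulVec_add, Matrix.mulVec_mulVec, Matrix.mulVec_mulVec, hBA]
      · have hc : Continuous fun x : ι → ℂ => B *ᵥ x := by fun_prop
        simpa [Function.comp_def] using (hc.tendsto 0).comp hh
      · intro t
        have h2 := h0 t
        rw [Multiset.map_cons, Multiset.prod_cons, mul_comm, map_mul] at h2
        have hX : Polynomial.aeval A (Polynomial.X - Polynomial.C μ) = B := by
          simp [hB, Algebra.algebraMap_eq_smul_one]
        rwa [hX, ← Matrix.mulVec_mulVec] at h2
    rw [tendsto_pi_nhds] at h1 ⊢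
    intro i
    refine (hy.apply i).tendsto_zero_of_scalar_ode (hs μ (Multiset.mem_cons_self _ _))
      (h := fun t => (B *ᵥ y t) i + h t i) ?_ ?_
    · filter_upwards [hd] with t ht
      refine (hasDerivAt_pi.1 ht i).congr_deriv ?_
      simp only [hB, Matrix.sub_mulVec, Matrix.smul_mulVec, Matrix.one_mulVec, Pi.add_apply,
        Pi.sub_apply, Pi.smul_apply, smul_eq_mul]
      ring
    · simpa using (h1 i).add (tendsto_pi_nhds.1 hh i)

/-- Solutions of `y' = A y + h` with `A` Hurwitz and `h → 0` tend to zero. -/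
theorem LocAC.tendsto_zero_of_isHurwitz {ι : Type*} [Fintype ι] [DecidableEq ι]
    {A : Matrix ι ι ℝ} (hA : IsHurwitz A) {y h : ℝ → ι → ℝ} (hy : LocAC y)
    (hd : ∀ᵐ t ∂(volume.restrict (Ici (0 : ℝ))), HasDerivAt y (A *ᵥ y t + h t) t)
    (hh : Tendsto h atTop (𝓝 0)) : Tendsto y atTop (𝓝 0) := by
  have hlim : Tendsto (fun t i => (y t i : ℂ)) atTop (𝓝 0) := by
    refine LocAC.tendsto_zero_of_roots (cplx A) (cplx A).charpoly.roots (fun μ hμ => hA μ ?_)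
      (h := fun t i => (h t i : ℂ)) ?_ ?_ ?_ ?_
    · rw [Matrix.mem_spectrum_iff_isRoot_charpoly]
      exact Polynomial.isRoot_of_mem_roots hμ
    · exact LocAC.pi fun i => (hy.apply i).clm_comp Complex.ofRealCLM
    · filter_upwards [hd] with t ht
      rw [hasDerivAt_pi]
      intro i
      refine (hasDerivAt_pi.1 ht i).ofReal_comp.congr_deriv ?_
      simp [cplx, Matrix.mulVec, dotProduct]
    · rw [tendsto_pi_nhds] at hh ⊢
      intro i
      exact (Complex.continuous_ofReal.tendsto' 0 0 (by simp)).comp (hh i)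
    · intro t
      -- Cayley–Hamilton: the product over the roots is the characteristic polynomial.
      rw [← (IsAlgClosed.splits (cplx A).charpoly).eq_prod_roots_of_monic
        (Matrix.charpoly_monic _), Matrix.aeval_self_charpoly, Matrix.zero_mulVec]
  rw [tendsto_pi_nhds] at hlim ⊢
  intro i
  simpa [Function.comp_def] using (Complex.continuous_re.tendsto' 0 0 (by simp)).comp (hlim i)

/-! ### Filippov regularisation -/

/-- Elements of the Filippov set agree with the vector field along every functional for which
the latter is continuous at the given point. -/
theorem map_eq_of_mem_filippovSet {E G : Type*} [NormedAddCommGroup E] [NormedSpace ℝ E]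
    [MeasureSpace E] [NormedAddCommGroup G] [NormedSpace ℝ G] {f : ℝ → E → E} {t : ℝ} {x v : E}
    (hv : v ∈ filippovSet f t x) (φ : E →L[ℝ] G) (hφ : ContinuousAt (fun y => φ (f t y)) x) :
    φ v = φ (f t x) := by
  refine eq_of_forall_dist_le fun ε hε => ?_
  obtain ⟨δ, hδ, hball⟩ := Metric.continuousAt_iff.1 hφ ε hε
  simp only [filippovSet, mem_iInter] at hv
  -- The empty null set suffices: the field already maps the ball into the preimage of a closed
  -- ball, which is convex and closed.
  have hmem := hv δ hδ ∅ measure_empty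
  have hsub : f t '' (Metric.ball x δ \ ∅) ⊆ φ ⁻¹' Metric.closedBall (φ (f t x)) ε := by
    rintro _ ⟨y, hy, rfl⟩
    exact (hball hy.1).le
  have hconv : Convex ℝ (φ ⁻¹' Metric.closedBall (φ (f t x)) ε) :=
    (convex_closedBall _ _).linear_preimage φ.toLinearMap
  have hclosed : IsClosed (φ ⁻¹' Metric.closedBall (φ (f t x)) ε) :=
    Metric.isClosed_closedBall.preimage φ.continuous
  exact closure_minimal (convexHull_min hsub hconv) hclosed hmem

/-! ### Lyapunov inequalities -/

section Lyapunov

variable {ι κ o : Type*} [Fintype ι] [Fintype κ] [Fintype o]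

theorem dotProduct_mulVec_comm_of_isHermitian {P : Matrix κ κ ℝ} (hP : P.IsHermitian)
    (x y : κ → ℝ) : x ⬝ᵥ P *ᵥ y = y ⬝ᵥ P *ᵥ x := by
  have hT : Pᵀ = P := by
    simpa [Matrix.IsHermitian, Matrix.conjTranspose_eq_transpose_of_trivial] using hP.eq
  rw [Matrix.dotProduct_mulVec, ← Matrix.mulVec_transpose, hT, dotProduct_comm]

theorem two_mul_dotProduct_mulVec (M : Matrix κ κ ℝ) (x : κ → ℝ) :
    2 * (x ⬝ᵥ M *ᵥ x) = x ⬝ᵥ (M + Mᵀ) *ᵥ x := by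
  have : x ⬝ᵥ Mᵀ *ᵥ x = x ⬝ᵥ M *ᵥ x := by
    rw [Matrix.dotProduct_mulVec, Matrix.vecMul_transpose, dotProduct_comm]
  rw [Matrix.add_mulVec, dotProduct_add, this]
  ring

/-- Since `H L = -Cᵀ`, the local correction contributes `-2 |C E_i|²`, which completes the matrix
inequality. The coupling contributes minus the quadratic form of `T`, one output coordinate at a
time. -/
theorem observer_lyapunov [DecidableEq κ] {A H : Matrix κ κ ℝ} {C : Matrix o κ ℝ}
    {L : Matrix κ o ℝ} (hH : H.PosDef) (hL : L = -(H⁻¹ * Cᵀ)) {T : Matrix ι ι ℝ}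
    (hT : T.PosSemidef) (E : ι → κ → ℝ) :
    2 * ∑ i, E i ⬝ᵥ H *ᵥ (A *ᵥ E i + L *ᵥ (C *ᵥ E i) + L *ᵥ (C *ᵥ ∑ k, T i k • E k)) ≤
      -∑ i, E i ⬝ᵥ (-(Aᵀ * H + H * A - (2 : ℝ) • (Cᵀ * C))) *ᵥ E i := by
  have hHL : H * L = -Cᵀ := by
    rw [hL, Matrix.mul_neg, ← Matrix.mul_assoc,
      Matrix.mul_nonsing_inv _ ((Matrix.isUnit_iff_isUnit_det _).1 hH.isUnit), Matrix.one_mul]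
  have hHT : Hᵀ = H := by
    simpa [Matrix.conjTranspose_eq_transpose_of_trivial] using hH.isHermitian.eq
  have hcross : ∀ x v : κ → ℝ, x ⬝ᵥ H *ᵥ (L *ᵥ (C *ᵥ v)) = -((C *ᵥ x) ⬝ᵥ (C *ᵥ v)) := by
    intro x v
    rw [Matrix.mulVec_mulVec, hHL, Matrix.neg_mulVec, dotProduct_neg, Matrix.dotProduct_mulVec,
      Matrix.vecMul_transpose]
  have hpsd : 0 ≤ ∑ i, (C *ᵥ E i) ⬝ᵥ (C *ᵥ ∑ k, T i k • E k) := by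
    have : ∑ i, (C *ᵥ E i) ⬝ᵥ (C *ᵥ ∑ k, T i k • E k) =
        ∑ a, (fun i => (C *ᵥ E i) a) ⬝ᵥ T *ᵥ (fun i => (C *ᵥ E i) a) := by
      simp only [Matrix.mulVec_sum, Matrix.mulVec_smul]
      simp only [dotProduct, Finset.sum_apply, Pi.smul_apply, smul_eq_mul]
      rw [Finset.sum_comm]
      rfl
    rw [this]
    exact Finset.sum_nonneg fun a _ => by simpa using hT.dotProduct_mulVec_nonneg _
  have hmain : ∀ x : κ → ℝ, 2 * (x ⬝ᵥ H *ᵥ (A *ᵥ x + L *ᵥ (C *ᵥ x))) =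
      -(x ⬝ᵥ (-(Aᵀ * H + H * A - (2 : ℝ) • (Cᵀ * C))) *ᵥ x) := by
    intro x
    rw [Matrix.mulVec_add, dotProduct_add, hcross, mul_add, Matrix.mulVec_mulVec,
      two_mul_dotProduct_mulVec, Matrix.transpose_mul, hHT, Matrix.neg_mulVec, dotProduct_neg,
      neg_neg, Matrix.sub_mulVec, dotProduct_sub, Matrix.smul_mulVec, dotProduct_smul,
      ← Matrix.mulVec_mulVec (M := Cᵀ), Matrix.dotProduct_mulVec x Cᵀ, Matrix.vecMul_transpose,
      add_comm (H * A)]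
    simp only [smul_eq_mul]
    ring
  have hsplit : ∀ i, E i ⬝ᵥ H *ᵥ (A *ᵥ E i + L *ᵥ (C *ᵥ E i) + L *ᵥ (C *ᵥ ∑ k, T i k • E k)) =
      E i ⬝ᵥ H *ᵥ (A *ᵥ E i + L *ᵥ (C *ᵥ E i)) - (C *ᵥ E i) ⬝ᵥ (C *ᵥ ∑ k, T i k • E k) := by
    intro i
    rw [Matrix.mulVec_add, dotProduct_add, hcross]
    ring
  simp only [hsplit, Finset.sum_sub_distrib, mul_sub]
  rw [Finset.mul_sum, Finset.sum_congr rfl fun i _ => hmain (E i), Finset.sum_neg_distrib]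
  linarith

/-- The pairing of the Lyapunov gradient with an input channel. -/
theorem sum_gradient_dot_input {P : Matrix κ κ ℝ} (hP : P.IsHermitian) [DecidableEq κ]
    {B : Matrix κ o ℝ} {K : Matrix o κ ℝ} (hK : K = -(Bᵀ * P⁻¹)) (R : Matrix ι ι ℝ)
    (δ : ι → κ → ℝ) (w : ι → o → ℝ) :
    ∑ i, (∑ k, R i k • δ k) ⬝ᵥ P⁻¹ *ᵥ (∑ k, R i k • (B *ᵥ w k)) =
      -∑ k, (K *ᵥ ∑ j, (Rᵀ * R) k j • δ j) ⬝ᵥ w k := by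
  have hPi : P⁻¹.IsHermitian := hP.inv
  have h1 : ∀ x : κ → ℝ, ∀ v : o → ℝ, x ⬝ᵥ P⁻¹ *ᵥ (B *ᵥ v) = -((K *ᵥ x) ⬝ᵥ v) := by
    intro x v
    rw [dotProduct_mulVec_comm_of_isHermitian hPi, hK, Matrix.neg_mulVec, neg_dotProduct, neg_neg,
      ← Matrix.mulVec_mulVec, Matrix.mulVec_transpose, ← Matrix.dotProduct_mulVec,
      dotProduct_comm]
  have h2 : ∀ k, K *ᵥ ∑ j, (Rᵀ * R) k j • δ j = ∑ i, R i k • K *ᵥ ∑ j, R i j • δ j := by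
    intro k
    simp only [← Matrix.mulVec_smul, ← Matrix.mulVec_sum]
    congr 1
    simp only [Matrix.mul_apply, Matrix.transpose_apply, Finset.sum_smul, Finset.smul_sum,
      smul_smul]
    exact Finset.sum_comm
  simp only [Matrix.mulVec_sum, Matrix.mulVec_smul, dotProduct_sum, dotProduct_smul, h1] at h2 ⊢
  simp only [h2, sum_dotProduct, smul_dotProduct, smul_neg, Finset.sum_neg_distrib]
  rw [Finset.sum_comm]

/-- With `ρ = R δ`, the drift gives the negative form plus `2 ∑ |K ρ_i|²`, because `Kᵀ K = P⁻¹ B Bᵀ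
P⁻¹`. The input gives `-2 ∑ s · (c₁ s + w)`. As `s` is `Rᵀ` applied to the family `K ρ_i`, `hR` lets
the gain `c₁` absorb the excess, and the part with `w` has the right sign. -/
theorem controller_lyapunov [DecidableEq κ] {A P : Matrix κ κ ℝ} {B : Matrix κ o ℝ}
    {K : Matrix o κ ℝ} (hP : P.PosDef) (hK : K = -(Bᵀ * P⁻¹)) {R : Matrix ι ι ℝ} {c₁ : ℝ}
    (hR : ∀ x : ι → ℝ, x ⬝ᵥ x ≤ c₁ * ((Rᵀ *ᵥ x) ⬝ᵥ (Rᵀ *ᵥ x))) (δ : ι → κ → ℝ) (s w : ι → o → ℝ)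
    (hs : ∀ i, s i = K *ᵥ ∑ k, (Rᵀ * R) i k • δ k)
    (hw : ∀ i a, 0 ≤ s i a * w i a) :
    2 * ∑ i, (∑ k, R i k • δ k) ⬝ᵥ
        P⁻¹ *ᵥ (∑ k, R i k • (A *ᵥ δ k + B *ᵥ (c₁ • s k + w k))) ≤
      -∑ i, (∑ k, R i k • δ k) ⬝ᵥ
        (P⁻¹ * (-(A * P + P * Aᵀ - (2 : ℝ) • (B * Bᵀ))) * P⁻¹) *ᵥ (∑ k, R i k • δ k) := by
  have hPu : IsUnit P.det := (Matrix.isUnit_iff_isUnit_det _).1 hP.isUnit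
  have hPT : Pᵀ = P := by
    simpa [Matrix.conjTranspose_eq_transpose_of_trivial] using hP.isHermitian.eq
  set ρ : ι → κ → ℝ := fun i => ∑ k, R i k • δ k with hρ
  have hin := sum_gradient_dot_input hP.isHermitian hK R δ (fun k => c₁ • s k + w k)
  simp only [← hs] at hin
  have hsplit : ∀ i, ∑ k, R i k • (A *ᵥ δ k + B *ᵥ (c₁ • s k + w k)) =
      A *ᵥ ρ i + ∑ k, R i k • (B *ᵥ (c₁ • s k + w k)) := by
    intro i
    simp only [smul_add, Finset.sum_add_distrib, hρ, Matrix.mulVec_sum, Matrix.mulVec_smul]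
  have hmat : P⁻¹ * A + (P⁻¹ * A)ᵀ =
      -(P⁻¹ * (-(A * P + P * Aᵀ - (2 : ℝ) • (B * Bᵀ))) * P⁻¹) + (2 : ℝ) • (Kᵀ * K) := by
    have e1 : P⁻¹ * (A * P) * P⁻¹ = P⁻¹ * A := by
      rw [Matrix.mul_assoc, Matrix.mul_assoc, Matrix.mul_nonsing_inv _ hPu, Matrix.mul_one]
    have e2 : P⁻¹ * (P * Aᵀ) * P⁻¹ = Aᵀ * P⁻¹ := by
      rw [← Matrix.mul_assoc P⁻¹, Matrix.nonsing_inv_mul _ hPu, Matrix.one_mul]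
    have e3 : Kᵀ * K = P⁻¹ * (B * Bᵀ) * P⁻¹ := by
      rw [hK, Matrix.transpose_neg, Matrix.neg_mul, Matrix.mul_neg, neg_neg, Matrix.transpose_mul,
        Matrix.transpose_transpose, Matrix.transpose_nonsing_inv, hPT]
      simp only [Matrix.mul_assoc]
    rw [Matrix.mul_neg, Matrix.neg_mul, neg_neg, Matrix.mul_sub, Matrix.sub_mul, Matrix.mul_add,
      Matrix.add_mul, e1, e2, e3, Matrix.transpose_mul, Matrix.transpose_nonsing_inv, hPT,
      Matrix.mul_smul, Matrix.smul_mul]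
    abel
  have hquad : ∀ i, 2 * (ρ i ⬝ᵥ P⁻¹ *ᵥ (A *ᵥ ρ i)) =
      -(ρ i ⬝ᵥ (P⁻¹ * (-(A * P + P * Aᵀ - (2 : ℝ) • (B * Bᵀ))) * P⁻¹) *ᵥ ρ i) +
        2 * ((K *ᵥ ρ i) ⬝ᵥ (K *ᵥ ρ i)) := by
    intro i
    rw [Matrix.mulVec_mulVec, two_mul_dotProduct_mulVec, hmat, Matrix.add_mulVec, dotProduct_add,
      Matrix.neg_mulVec, dotProduct_neg, Matrix.smul_mulVec, dotProduct_smul, smul_eq_mul,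
      ← Matrix.mulVec_mulVec (ρ i) Kᵀ K, Matrix.dotProduct_mulVec (ρ i) Kᵀ, Matrix.vecMul_transpose]
  have hsR : ∀ a k, s k a = (Rᵀ *ᵥ fun i => (K *ᵥ ρ i) a) k := by
    intro a k
    have h2 : K *ᵥ ∑ j, (Rᵀ * R) k j • δ j = ∑ i, R i k • K *ᵥ ρ i := by
      simp only [← Matrix.mulVec_smul, ← Matrix.mulVec_sum, hρ]
      congr 1
      simp only [Matrix.mul_apply, Matrix.transpose_apply, Finset.sum_smul, Finset.smul_sum,
        smul_smul]
      exact Finset.sum_comm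
    rw [hs, h2]
    simp [Matrix.mulVec, dotProduct, Finset.sum_apply]
  have hgain : ∑ i, (K *ᵥ ρ i) ⬝ᵥ (K *ᵥ ρ i) ≤ c₁ * ∑ i, s i ⬝ᵥ s i := by
    have e1 : ∑ i, (K *ᵥ ρ i) ⬝ᵥ (K *ᵥ ρ i) =
        ∑ a, (fun i => (K *ᵥ ρ i) a) ⬝ᵥ (fun i => (K *ᵥ ρ i) a) := Finset.sum_comm
    have e2 : ∑ i, s i ⬝ᵥ s i = ∑ a, (Rᵀ *ᵥ fun i => (K *ᵥ ρ i) a) ⬝ᵥ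
        (Rᵀ *ᵥ fun i => (K *ᵥ ρ i) a) := by
      simp only [dotProduct, hsR]
      exact Finset.sum_comm
    rw [e1, e2, Finset.mul_sum]
    exact Finset.sum_le_sum fun a _ => hR _
  have hwn : 0 ≤ ∑ k, s k ⬝ᵥ w k :=
    Finset.sum_nonneg fun k _ => Finset.sum_nonneg fun a _ => hw k a
  have hexp : ∑ k, s k ⬝ᵥ (c₁ • s k + w k) = c₁ * ∑ k, s k ⬝ᵥ s k + ∑ k, s k ⬝ᵥ w k := by
    simp only [dotProduct_add, dotProduct_smul, Finset.sum_add_distrib, smul_eq_mul,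
      Finset.mul_sum]
  have htot : ∑ i, ρ i ⬝ᵥ P⁻¹ *ᵥ (∑ k, R i k • (A *ᵥ δ k + B *ᵥ (c₁ • s k + w k))) =
      ∑ i, ρ i ⬝ᵥ P⁻¹ *ᵥ (A *ᵥ ρ i) +
        ∑ i, ρ i ⬝ᵥ P⁻¹ *ᵥ (∑ k, R i k • (B *ᵥ (c₁ • s k + w k))) := by
    rw [← Finset.sum_add_distrib]
    exact Finset.sum_congr rfl fun i _ => by rw [hsplit, Matrix.mulVec_add, dotProduct_add]
  have hq := Finset.sum_congr (rfl : (Finset.univ : Finset ι) = Finset.univ)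
    fun i _ => hquad i
  rw [← Finset.mul_sum, Finset.sum_add_distrib, Finset.sum_neg_distrib, ← Finset.mul_sum] at hq
  rw [htot, hin, hexp]
  linarith

end Lyapunov

/-- The follower gain dominates the inverse of the smallest eigenvalue. -/
theorem dotProduct_self_le_of_lambdaMin {ι : Type*} [Fintype ι] [DecidableEq ι]
    {R : Matrix ι ι ℝ} (hR : IsUnit R.det) {c : ℝ} (hc : 1 / lambdaMin (Rᵀ * R) < c)
    (x : ι → ℝ) : x ⬝ᵥ x ≤ c * ((Rᵀ *ᵥ x) ⬝ᵥ (Rᵀ *ᵥ x)) := by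
  rcases isEmpty_or_nonempty ι with he | hne
  · simp [dotProduct]
  have hG : (Rᵀ * R).PosDef := by
    have := Matrix.PosDef.conjTranspose_mul_self R
      (Matrix.mulVec_injective_iff_isUnit.2 ((Matrix.isUnit_iff_isUnit_det _).2 hR))
    simpa [Matrix.conjTranspose_eq_transpose_of_trivial] using this
  have hspec : spectrum ℝ (Rᵀ * R) = range hG.isHermitian.eigenvalues :=
    hG.isHermitian.spectrum_real_eq_range_eigenvalues
  have hmem : lambdaMin (Rᵀ * R) ∈ spectrum ℝ (Rᵀ * R) := by
    refine Set.Nonempty.csInf_mem ?_ ?_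
    · rw [hspec]; exact range_nonempty _
    · rw [hspec]; exact finite_range _
  have hpos : 0 < lambdaMin (Rᵀ * R) := by
    rw [hspec] at hmem
    obtain ⟨i, hi⟩ := hmem
    rw [← hi]
    exact hG.eigenvalues_pos i
  have hle : ∀ μ ∈ spectrum ℝ (Rᵀ * R), lambdaMin (Rᵀ * R) ≤ μ := by
    intro μ hμ
    refine csInf_le ?_ hμ
    rw [hspec]
    exact (finite_range _).bddBelow
  have hpsd : (R * Rᵀ - algebraMap ℝ (Matrix ι ι ℝ) (lambdaMin (Rᵀ * R))).PosSemidef := by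
    rw [Matrix.posSemidef_iff_isHermitian_and_spectrum_nonneg]
    refine ⟨?_, ?_⟩
    · refine Matrix.IsHermitian.sub ?_ ?_
      · have := Matrix.isHermitian_mul_conjTranspose_self R
        simpa [Matrix.conjTranspose_eq_transpose_of_trivial] using this
      · rw [Algebra.algebraMap_eq_smul_one]
        simp [Matrix.IsHermitian]
    · rw [← spectrum.sub_singleton_eq]
      rintro _ ⟨μ, hμ, _, rfl, rfl⟩
      -- The estimate concerns `R Rᵀ` and the gain condition `Rᵀ R`; they have the same
      -- characteristic polynomial.
      rw [Matrix.mem_spectrum_iff_isRoot_charpoly, Matrix.charpoly_mul_comm,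
        ← Matrix.mem_spectrum_iff_isRoot_charpoly] at hμ
      simpa using hle μ hμ
  have h1 := hpsd.dotProduct_mulVec_nonneg x
  rw [Matrix.sub_mulVec, dotProduct_sub, Algebra.algebraMap_eq_smul_one, Matrix.smul_mulVec,
    Matrix.one_mulVec, dotProduct_smul, ← Matrix.mulVec_mulVec, star_trivial,
    Matrix.dotProduct_mulVec, ← Matrix.mulVec_transpose, smul_eq_mul] at h1
  have h2 : 0 ≤ x ⬝ᵥ x := Finset.sum_nonneg fun i _ => mul_self_nonneg (x i)
  have h3 : 1 ≤ c * lambdaMin (Rᵀ * R) := by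
    rw [div_lt_iff₀ hpos] at hc
    exact hc.le
  have hcpos : 0 < c := (by positivity : 0 < 1 / lambdaMin (Rᵀ * R)).trans hc
  calc x ⬝ᵥ x ≤ c * lambdaMin (Rᵀ * R) * (x ⬝ᵥ x) := le_mul_of_one_le_left h2 h3
    _ = c * (lambdaMin (Rᵀ * R) * (x ⬝ᵥ x)) := by ring
    _ ≤ _ := by gcongr; linarith

/-! ### Follower errors and interaction weights -/

/-- The error `a_i + ∑ⱼ σ_ij a_j` of every follower, for a quantity `a` of the agents. -/
noncomputable def follErr {nl nf : ℕ} {E : Type*} [NormedAddCommGroup E] [NormedSpace ℝ E]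
    (σ : Matrix (Fin nf) (Fin nl) ℝ) : (Agent nl nf → E) →L[ℝ] (Fin nf → E) :=
  ContinuousLinearMap.pi fun i =>
    ContinuousLinearMap.proj (R := ℝ) (φ := fun _ : Agent nl nf => E) (Sum.inr i) +
      ∑ j, σ i j • ContinuousLinearMap.proj (R := ℝ) (φ := fun _ : Agent nl nf => E) (Sum.inl j)

theorem follErr_apply {nl nf : ℕ} {E : Type*} [NormedAddCommGroup E] [NormedSpace ℝ E]
    (σ : Matrix (Fin nf) (Fin nl) ℝ) (a : Agent nl nf → E) (i : Fin nf) :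
    follErr σ a i = a (Sum.inr i) + ∑ j, σ i j • a (Sum.inl j) := by
  simp [follErr]

/-- Linear combinations of the members of a family, with the rows of `R` as coefficients. -/
noncomputable def mixRows {ι E : Type*} [Fintype ι] [NormedAddCommGroup E] [NormedSpace ℝ E]
    (R : Matrix ι ι ℝ) : (ι → E) →L[ℝ] (ι → E) :=
  ContinuousLinearMap.pi fun i =>
    ∑ k, R i k • ContinuousLinearMap.proj (R := ℝ) (φ := fun _ : ι => E) k

theorem mixRows_apply {ι E : Type*} [Fintype ι] [NormedAddCommGroup E] [NormedSpace ℝ E]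
    (R : Matrix ι ι ℝ) (a : ι → E) (i : ι) : mixRows R a i = ∑ k, R i k • a k := by
  simp [mixRows]

theorem mixRows_inv {ι E : Type*} [Fintype ι] [DecidableEq ι] [NormedAddCommGroup E]
    [NormedSpace ℝ E] {R : Matrix ι ι ℝ} (hR : IsUnit R.det) (a : ι → E) :
    mixRows R⁻¹ (mixRows R a) = a := by
  funext i
  simp only [mixRows_apply, Finset.smul_sum, smul_smul]
  rw [Finset.sum_comm]
  simp only [← Finset.sum_smul, ← Matrix.mul_apply, Matrix.nonsing_inv_mul _ hR,
    Matrix.one_apply, ite_smul, one_smul, zero_smul]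
  simp

/-- The interaction matrix `Ψ` factors through the follower errors, with block `S`. -/
structure FactorsThrough {nl nf : ℕ} (Ψ : Matrix (Fin nf) (Agent nl nf) ℝ)
    (S : Matrix (Fin nf) (Fin nf) ℝ) (σ : Matrix (Fin nf) (Fin nl) ℝ) : Prop where
  ff : ∀ i k, Ψ i (Sum.inr k) = S i k
  fl : ∀ i j, Ψ i (Sum.inl j) = ∑ k, S i k * σ k j
  row : ∀ i, ∑ j, Ψ i j = 0

theorem FactorsThrough.sum_smul {nl nf : ℕ} {Ψ : Matrix (Fin nf) (Agent nl nf) ℝ}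
    {S : Matrix (Fin nf) (Fin nf) ℝ} {σ : Matrix (Fin nf) (Fin nl) ℝ}
    (h : FactorsThrough Ψ S σ) {E : Type*} [NormedAddCommGroup E] [NormedSpace ℝ E]
    (a : Agent nl nf → E) (i : Fin nf) :
    ∑ j, Ψ i j • a j = ∑ k, S i k • follErr σ a k := by
  rw [Fintype.sum_sum_type]
  simp only [h.ff, h.fl, follErr_apply, smul_add, Finset.sum_add_distrib, Finset.sum_smul,
    Finset.smul_sum, smul_smul]
  rw [add_comm, Finset.sum_comm]

/-- Zero row sums remove the agent's own term, so relative measurements carry just the follower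
errors. -/
theorem FactorsThrough.sum_edgeWeight {nl nf : ℕ} {Ψ : Matrix (Fin nf) (Agent nl nf) ℝ}
    {S : Matrix (Fin nf) (Fin nf) ℝ} {σ : Matrix (Fin nf) (Fin nl) ℝ}
    (h : FactorsThrough Ψ S σ) {E : Type*} [NormedAddCommGroup E] [NormedSpace ℝ E]
    (a : Agent nl nf → E) (i : Fin nf) :
    ∑ j, edgeWeight Ψ i j • (a (Sum.inr i) - a j) = ∑ k, S i k • follErr σ a k := by
  rw [← h.sum_smul]
  simp only [edgeWeight, neg_smul, smul_sub, Finset.sum_sub_distrib, Finset.sum_neg_distrib,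
    ← Finset.sum_smul, h.row, zero_smul, neg_zero, zero_sub, neg_neg]

theorem followerMatrix_row_sum {nl nf : ℕ} (F : NominalFormation nl nf)
    (w : Fin nf → Agent nl nf → ℝ) (i : Fin nf) : ∑ j, F.followerMatrix w i j = 0 := by
  classical
  -- Without self-loops the diagonal entry does not compete with an edge weight.
  have hi : Sum.inr i ∉ F.nbrs (Sum.inr i) := by
    simp [NominalFormation.nbrs, F.loopless]
  have : ∀ j, F.followerMatrix w i j =
      (if j = Sum.inr i then ∑ k ∈ F.nbrs (Sum.inr i), w i k else 0) -
        (if j ∈ F.nbrs (Sum.inr i) then w i j else 0) := by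
    intro j
    simp only [NominalFormation.followerMatrix, Matrix.of_apply]
    by_cases hj : j = Sum.inr i
    · simp [hj, hi]
    · by_cases hn : j ∈ F.nbrs (Sum.inr i) <;> simp [hj, hn]
  simp only [this, Finset.sum_sub_distrib]
  simp

/-- Left multiplication preserves both zero row sums and the identity `Ω_fl = Ω_ff σ`. It serves for
`T = Ω_ff⁻¹`, `Ω_ffᵀ` and `1`. -/
theorem factorsThrough_mul {nl nf : ℕ} {Ω : Matrix (Fin nf) (Agent nl nf) ℝ}
    (hloc : IsLocalizable Ω) (hrow : ∀ i, ∑ j, Ω i j = 0) (T : Matrix (Fin nf) (Fin nf) ℝ) :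
    FactorsThrough (T * Ω) (T * blockFF Ω) (sigmaMat Ω) where
  ff i k := by simp [Matrix.mul_apply, blockFF]
  fl i j := by
    have h : T * blockFF Ω * sigmaMat Ω = T * blockFL Ω := by
      rw [sigmaMat, Matrix.mul_assoc, ← Matrix.mul_assoc (blockFF Ω),
        Matrix.mul_nonsing_inv _ hloc, Matrix.one_mul]
    rw [← Matrix.mul_apply, h]
    simp [Matrix.mul_apply, blockFL]
  row i := by
    simp only [Matrix.mul_apply]
    rw [Finset.sum_comm]
    simp [← Finset.mul_sum, hrow]

/-- Both modified follower matrices have a follower block of the form `Rᵀ R`. -/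
theorem exists_factorsThrough {nl nf : ℕ} {Ω Ψ : Matrix (Fin nf) (Agent nl nf) ℝ}
    (hloc : IsLocalizable Ω) (hrow : ∀ i, ∑ j, Ω i j = 0) {c₁ : ℝ}
    (hc₁ : max 1 (1 / lambdaMin ((blockFF Ω)ᵀ * blockFF Ω)) < c₁)
    (hΨ : Ψ = barMatrix Ω ∨ Ψ = hatMatrix Ω) :
    ∃ R : Matrix (Fin nf) (Fin nf) ℝ, IsUnit R.det ∧ FactorsThrough Ψ (Rᵀ * R) (sigmaMat Ω) ∧
      ∀ x : Fin nf → ℝ, x ⬝ᵥ x ≤ c₁ * ((Rᵀ *ᵥ x) ⬝ᵥ (Rᵀ *ᵥ x)) := by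
  obtain ⟨h1, h2⟩ := max_lt_iff.1 hc₁
  rcases hΨ with rfl | rfl
  -- For `barMatrix` the follower block is the identity and the bound is `1 ≤ c₁`; for `hatMatrix`
  -- one takes `R = Ω_ff`.
  · refine ⟨1, by simp, ?_, fun x => ?_⟩
    · have := factorsThrough_mul hloc hrow (blockFF Ω)⁻¹
      rw [Matrix.nonsing_inv_mul _ hloc] at this
      simpa [barMatrix] using this
    · have h0 : 0 ≤ x ⬝ᵥ x := Finset.sum_nonneg fun i _ => mul_self_nonneg (x i)
      simpa using le_mul_of_one_le_left h0 h1.le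
  · exact ⟨blockFF Ω, hloc, factorsThrough_mul hloc hrow _,
      dotProduct_self_le_of_lambdaMin hloc h2⟩

/-! ### Closed-loop equations -/

section ClosedLoop

variable {nl nf m q : ℕ}

/-- The estimates of the agents. -/
noncomputable def estimates : NetState nl nf m →L[ℝ] (Agent nl nf → Vec m) :=
  ContinuousLinearMap.pi fun i => (ContinuousLinearMap.snd ℝ (Vec m) (Vec m)).comp
    (ContinuousLinearMap.proj (R := ℝ) (φ := fun _ : Agent nl nf => Vec m × Vec m) i)

/-- The estimation errors of the agents. -/
noncomputable def estErr : NetState nl nf m →L[ℝ] (Agent nl nf → Vec m) :=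
  ContinuousLinearMap.pi fun i =>
    (ContinuousLinearMap.snd ℝ (Vec m) (Vec m) - ContinuousLinearMap.fst ℝ (Vec m) (Vec m)).comp
    (ContinuousLinearMap.proj (R := ℝ) (φ := fun _ : Agent nl nf => Vec m × Vec m) i)

@[simp] theorem estimates_apply (z : NetState nl nf m) (i : Agent nl nf) :
    estimates z i = (z i).2 := rfl

@[simp] theorem estErr_apply (z : NetState nl nf m) (i : Agent nl nf) :
    estErr z i = (z i).2 - (z i).1 := rfl

variable {D : Maneuver nl nf} {Ψ : Matrix (Fin nf) (Agent nl nf) ℝ}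
    {C : Matrix (Fin q) (Fin m × Fin 3) ℝ} {β : Fin m → ℝ} {K : Matrix (Fin 3) (Fin m × Fin 3) ℝ}
    {L : Matrix (Fin m × Fin 3) (Fin q) ℝ} {c₁ c₂ t : ℝ} {S : Matrix (Fin nf) (Fin nf) ℝ}
    {σ : Matrix (Fin nf) (Fin nl) ℝ}

theorem estErr_closedLoop_leader (z : NetState nl nf m) (j : Fin nl) :
    estErr (closedLoop D Ψ C β K L c₁ c₂ t z) (Sum.inl j) =
      matA m *ᵥ estErr z (Sum.inl j) + L *ᵥ (C *ᵥ estErr z (Sum.inl j)) := by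
  simp only [estErr_apply, closedLoop, Sum.elim_inl, Matrix.mulVec_sub]
  abel

theorem sum_edgeWeight_output (hΨ : FactorsThrough Ψ S σ) (z : NetState nl nf m) (i : Fin nf) :
    ∑ j, edgeWeight Ψ i j • (C *ᵥ ((z (Sum.inr i)).2 - (z j).2) -
      (C *ᵥ (z (Sum.inr i)).1 - C *ᵥ (z j).1)) =
      C *ᵥ ∑ k, S i k • follErr σ (estErr z) k := by
  rw [← hΨ.sum_edgeWeight, Matrix.mulVec_sum]
  refine Finset.sum_congr rfl fun j _ => ?_
  rw [Matrix.mulVec_smul]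
  simp only [estErr_apply, Matrix.mulVec_sub]
  congr 1
  abel

/-- The inputs, signum included, cancel between state and estimate, leaving an autonomous linear
system. -/
theorem follErr_estErr_closedLoop (hΨ : FactorsThrough Ψ S σ) (z : NetState nl nf m)
    (i : Fin nf) :
    follErr σ (estErr (closedLoop D Ψ C β K L c₁ c₂ t z)) i =
      matA m *ᵥ follErr σ (estErr z) i + L *ᵥ (C *ᵥ follErr σ (estErr z) i) +
        L *ᵥ (C *ᵥ ∑ k, (c₁ • S) i k • follErr σ (estErr z) k) := by
  have h1 : estErr (closedLoop D Ψ C β K L c₁ c₂ t z) (Sum.inr i) =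
      matA m *ᵥ estErr z (Sum.inr i) + L *ᵥ (C *ᵥ estErr z (Sum.inr i)) +
        c₁ • (L *ᵥ (C *ᵥ ∑ k, S i k • follErr σ (estErr z) k)) := by
    rw [← sum_edgeWeight_output hΨ]
    simp only [estErr_apply, closedLoop, Sum.elim_inr, Matrix.mulVec_sub]
    abel
  have h2 : ∑ k, (c₁ • S) i k • follErr σ (estErr z) k =
      c₁ • ∑ k, S i k • follErr σ (estErr z) k := by
    simp only [Finset.smul_sum, smul_smul, Matrix.smul_apply, smul_eq_mul]
  rw [follErr_apply, h1, h2]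
  simp only [estErr_closedLoop_leader, follErr_apply (i := i), Matrix.mulVec_add,
    Matrix.mulVec_sum, Matrix.mulVec_smul, smul_add, Finset.sum_add_distrib]
  abel

/-- The grouping separates what enters through `B`, where the signum can act, from terms driven by
the estimation errors, which vanish. -/
theorem follErr_estimates_closedLoop (hΨ : FactorsThrough Ψ S σ) (z : NetState nl nf m)
    (i : Fin nf) :
    follErr σ (estimates (closedLoop D Ψ C β K L c₁ c₂ t z)) i =
      matA m *ᵥ follErr σ (estimates z) i +
      matB m *ᵥ (c₁ • (K *ᵥ ∑ k, S i k • follErr σ (estimates z) k) +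
        c₂ • sgnVec (K *ᵥ ∑ k, S i k • follErr σ (estimates z) k) +
        ∑ j, σ i j • leaderInput D β t z j) +
      (L *ᵥ (C *ᵥ follErr σ (estErr z) i) +
        c₁ • (L *ᵥ (C *ᵥ ∑ k, S i k • follErr σ (estErr z) k))) := by
  have hu : followerInput Ψ K c₁ c₂ z i =
      c₁ • (K *ᵥ ∑ k, S i k • follErr σ (estimates z) k) +
        c₂ • sgnVec (K *ᵥ ∑ k, S i k • follErr σ (estimates z) k) := by
    rw [← hΨ.sum_edgeWeight]
    rfl
  rw [follErr_apply, ← hu, ← sum_edgeWeight_output hΨ]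
  simp only [estimates_apply, estErr_apply, closedLoop, Sum.elim_inr, Sum.elim_inl,
    follErr_apply (i := i), Matrix.mulVec_add, Matrix.mulVec_sub, Matrix.mulVec_sum,
    Matrix.mulVec_smul, smul_add, smul_sub, Finset.sum_add_distrib, Finset.sum_sub_distrib]
  abel

end ClosedLoop

/-! ### The desired motion -/

section Desired

variable {nl nf m : ℕ} {D : Maneuver nl nf} {Ω : Matrix (Fin nf) (Agent nl nf) ℝ} {γ : ℕ → ℝ}

theorem abs_apply_le_norm2 {ι : Type*} [Fintype ι] (v : ι → ℝ) (i : ι) : |v i| ≤ norm2 v := by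
  rw [norm2, ← Real.sqrt_sq_eq_abs]
  exact Real.sqrt_le_sqrt (Finset.single_le_sum (f := fun i => v i ^ 2)
    (fun i _ => sq_nonneg _) (Finset.mem_univ i))

theorem norm2_nonneg {ι : Type*} [Fintype ι] (v : ι → ℝ) : 0 ≤ norm2 v := Real.sqrt_nonneg _

theorem norm_le_norm2 {ι : Type*} [Fintype ι] (v : ι → ℝ) : ‖v‖ ≤ norm2 v :=
  (pi_norm_le_iff_of_nonneg (norm2_nonneg v)).2 fun i => abs_apply_le_norm2 v i

theorem Maneuver.hasDerivWithinAt_posDeriv (hγ : D.HasBoundedDerivs m γ) (j : Fin nl) {k : ℕ}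
    (hk : k < m) {t : ℝ} (ht : 0 ≤ t) :
    HasDerivWithinAt (D.posDeriv (Sum.inl j) k) (D.posDeriv (Sum.inl j) (k + 1) t) (Ici 0) t := by
  have h := (((hγ j).1 k hk) t ht).hasDerivWithinAt
  have e : D.posDeriv (Sum.inl j) (k + 1) t =
      derivWithin (D.posDeriv (Sum.inl j) k) (Ici 0) t := by
    simp only [Maneuver.posDeriv]
    rw [iteratedDerivWithin_succ]
    rfl
  rwa [e]

/-- The next derivative is bounded, so this one is Lipschitz. -/
theorem Maneuver.locAC_posDeriv (hγ : D.HasBoundedDerivs m γ) (j : Fin nl) {k : ℕ}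
    (hk : k < m) : LocAC (D.posDeriv (Sum.inl j) k) := by
  have hb : ∀ t ∈ Ici (0 : ℝ), ‖D.posDeriv (Sum.inl j) (k + 1) t‖₊ ≤ (γ (k + 1)).toNNReal := by
    intro t ht
    rw [← NNReal.coe_le_coe, coe_nnnorm]
    exact (norm_le_norm2 _).trans (((hγ j).2 (k + 1) (by omega) (by omega) t ht).trans
      (Real.le_coe_toNNReal _))
  have hlip := Convex.lipschitzOnWith_of_nnnorm_hasDerivWithin_le (convex_Ici (0 : ℝ))
    (fun t ht => Maneuver.hasDerivWithinAt_posDeriv hγ j hk ht) hb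
  intro T hT
  refine (hlip.mono ?_).absolutelyContinuousOnInterval
  rw [uIcc_of_le hT]
  exact Icc_subset_Ici_self

/-- The desired positions of the followers are determined by those of the leaders. -/
theorem Maneuver.pos_follower (hloc : IsLocalizable Ω) (hrow : ∀ i, ∑ j, Ω i j = 0)
    (hD : D.IsAdmissible Ω) (i : Fin nf) {t : ℝ} (ht : 0 ≤ t) :
    D.pos (Sum.inr i) t = -∑ j, sigmaMat Ω i j • D.pos (Sum.inl j) t := by
  have hf := factorsThrough_mul hloc hrow 1
  rw [Matrix.one_mul, Matrix.one_mul] at hf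
  have hg : follErr (sigmaMat Ω) (fun i => D.g i t) = 0 := by
    rw [← mixRows_inv hloc (follErr (sigmaMat Ω) (fun i => D.g i t))]
    have : mixRows (blockFF Ω) (follErr (sigmaMat Ω) (fun i => D.g i t)) = 0 := by
      funext i
      rw [mixRows_apply, ← hf.sum_smul, Fintype.sum_sum_type]
      exact (hD t ht).2 i
    rw [this, map_zero]
  -- The rows of `σ` sum to `-1`, so the common translation `b` satisfies the relation too.
  have h1 : follErr (sigmaMat Ω) (fun _ => (1 : ℝ)) = 0 := by
    rw [← mixRows_inv hloc (follErr (sigmaMat Ω) (fun _ => (1 : ℝ)))]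
    have : mixRows (blockFF Ω) (follErr (sigmaMat Ω) (fun _ => (1 : ℝ))) = 0 := by
      funext i
      rw [mixRows_apply, ← hf.sum_smul]
      simpa using hrow i
    rw [this, map_zero]
  have hgi := congrFun hg i
  have h1i := congrFun h1 i
  rw [follErr_apply] at hgi h1i
  simp only [smul_eq_mul, mul_one, Pi.zero_apply] at hgi h1i
  have hgi' : D.g (Sum.inr i) t = -∑ j, sigmaMat Ω i j • D.g (Sum.inl j) t :=
    eq_neg_of_add_eq_zero_left hgi
  simp only [Maneuver.pos, smul_add, Finset.sum_add_distrib, ← Finset.sum_smul, hgi',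
    eq_neg_of_add_eq_zero_right h1i, Matrix.mulVec_neg, Matrix.mulVec_sum, Matrix.mulVec_smul,
    smul_neg, Finset.smul_sum, neg_add, neg_smul, one_smul, neg_neg]
  congr 2
  exact Finset.sum_congr rfl fun j _ => smul_comm _ _ _

/-- Smoothness is assumed for the leaders only; the follower derivatives inherit it by induction on
the order. -/
theorem Maneuver.posDeriv_follower (hloc : IsLocalizable Ω) (hrow : ∀ i, ∑ j, Ω i j = 0)
    (hD : D.IsAdmissible Ω) (hγ : D.HasBoundedDerivs m γ) (i : Fin nf) {k : ℕ} (hk : k ≤ m)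
    {t : ℝ} (ht : 0 ≤ t) :
    D.posDeriv (Sum.inr i) k t = -∑ j, sigmaMat Ω i j • D.posDeriv (Sum.inl j) k t := by
  induction k generalizing t with
  | zero => simpa [Maneuver.posDeriv] using Maneuver.pos_follower hloc hrow hD i ht
  | succ k ih =>
    have h : HasDerivWithinAt
        (fun t => -∑ j, sigmaMat Ω i j • D.posDeriv (Sum.inl j) k t)
        (-∑ j, sigmaMat Ω i j • D.posDeriv (Sum.inl j) (k + 1) t) (Ici 0) t := by
      refine HasDerivWithinAt.neg (HasDerivWithinAt.fun_sum fun j _ => ?_)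
      exact (Maneuver.hasDerivWithinAt_posDeriv (k := k) hγ j (by omega) ht).const_smul
        (sigmaMat Ω i j)
    have h2 : HasDerivWithinAt (D.posDeriv (Sum.inr i) k)
        (-∑ j, sigmaMat Ω i j • D.posDeriv (Sum.inl j) (k + 1) t) (Ici 0) t :=
      h.congr (fun s hs => ih (by omega) hs) (ih (by omega) ht)
    have e : D.posDeriv (Sum.inr i) (k + 1) t =
        derivWithin (D.posDeriv (Sum.inr i) k) (Ici 0) t := by
      simp only [Maneuver.posDeriv]
      rw [iteratedDerivWithin_succ]
      rfl
    rw [e]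
    exact h2.derivWithin (uniqueDiffOn_Ici 0 t ht)

end Desired

/-! ### Trajectories -/

section Trajectories

theorem IsFilippovSolution.locAC {E : Type*} [NormedAddCommGroup E] [NormedSpace ℝ E]
    [MeasureSpace E] {f : ℝ → E → E} {x : ℝ → E} (hx : IsFilippovSolution f x) : LocAC x :=
  hx.1

/-- Along functionals for which the field is continuous, a Filippov solution is a solution. -/
theorem IsFilippovSolution.ae_hasDerivAt {E G : Type*} [NormedAddCommGroup E] [NormedSpace ℝ E]
    [MeasureSpace E] [NormedAddCommGroup G] [NormedSpace ℝ G] {f : ℝ → E → E} {x : ℝ → E}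
    (hx : IsFilippovSolution f x) (φ : E →L[ℝ] G)
    (hφ : ∀ t, ContinuousAt (fun y => φ (f t y)) (x t)) :
    ∀ᵐ t ∂(volume.restrict (Ici (0 : ℝ))), HasDerivAt (fun s => φ (x s)) (φ (f t (x t))) t := by
  filter_upwards [hx.2] with t ⟨v, hv, hd⟩
  rw [← map_eq_of_mem_filippovSet hv φ (hφ t)]
  exact φ.hasFDerivAt.comp_hasDerivAt t hd

variable {nl nf m q : ℕ} {D : Maneuver nl nf} {Ψ : Matrix (Fin nf) (Agent nl nf) ℝ}
    {C : Matrix (Fin q) (Fin m × Fin 3) ℝ} {β : Fin m → ℝ} {K : Matrix (Fin 3) (Fin m × Fin 3) ℝ}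
    {L : Matrix (Fin m × Fin 3) (Fin q) ℝ} {c₁ c₂ : ℝ} {S : Matrix (Fin nf) (Fin nf) ℝ}
    {σ : Matrix (Fin nf) (Fin nl) ℝ} {H : Matrix (Fin m × Fin 3) (Fin m × Fin 3) ℝ}
    {z : ℝ → NetState nl nf m}

/-- The estimation errors governed by a positive semidefinite coupling vanish. -/
theorem LocAC.tendsto_zero_of_observer {ι κ o : Type*} [Fintype ι] [Fintype κ] [Fintype o]
    [DecidableEq κ] {A H : Matrix κ κ ℝ} {C : Matrix o κ ℝ} {L : Matrix κ o ℝ} (hH : H.PosDef)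
    (hHlmi : (-(Aᵀ * H + H * A - (2 : ℝ) • (Cᵀ * C))).PosDef) (hL : L = -(H⁻¹ * Cᵀ))
    {T : Matrix ι ι ℝ} (hT : T.PosSemidef) {E : ℝ → ι → κ → ℝ} (hE : LocAC E)
    (hd : ∀ᵐ t ∂(volume.restrict (Ici (0 : ℝ))), HasDerivAt E
      (fun i => A *ᵥ E t i + L *ᵥ (C *ᵥ E t i) + L *ᵥ (C *ᵥ ∑ k, T i k • E t k)) t) :
    Tendsto E atTop (𝓝 0) := by
  obtain ⟨α, hα, hlow⟩ := posDef_lower_sum (ι := ι) hHlmi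
  refine hE.tendsto_zero_of_energy hH (h := fun _ => 0) hα tendsto_const_nhds ?_
  filter_upwards [hd] with t ht
  refine ⟨_, ht, ?_⟩
  have h1 := observer_lyapunov (A := A) hH hL hT (E t)
  have h2 := hlow (E t)
  simp only [Pi.zero_apply, Matrix.mulVec_zero, dotProduct_zero, Finset.sum_const_zero, mul_zero]
  linarith

theorem tendsto_estErr_leader (hH : H.PosDef)
    (hHlmi : (-((matA m)ᵀ * H + H * matA m - (2 : ℝ) • (Cᵀ * C))).PosDef)
    (hL : L = -(H⁻¹ * Cᵀ)) (hz : IsFilippovSolution (closedLoop D Ψ C β K L c₁ c₂) z)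
    (j : Fin nl) : Tendsto (fun t => estErr (z t) (Sum.inl j)) atTop (𝓝 0) := by
  set φ : NetState nl nf m →L[ℝ] (Fin nl → Vec m) := (ContinuousLinearMap.pi fun j =>
    ContinuousLinearMap.proj (R := ℝ) (φ := fun _ : Agent nl nf => Vec m) (Sum.inl j)).comp
      estErr with hφ
  have hφa : ∀ y j, φ y j = estErr y (Sum.inl j) := fun _ _ => rfl
  have hfield : ∀ t y, φ (closedLoop D Ψ C β K L c₁ c₂ t y) = fun j =>
      matA m *ᵥ φ y j + L *ᵥ (C *ᵥ φ y j) := by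
    intro t y
    funext j
    simp only [hφa]
    exact estErr_closedLoop_leader y j
  have hlim : Tendsto (fun t => φ (z t)) atTop (𝓝 0) := by
    -- Leaders are uncoupled, which is the case of zero coupling matrix.
    refine (hz.locAC.clm_comp φ).tendsto_zero_of_observer hH hHlmi hL
      (Matrix.PosSemidef.zero : (0 : Matrix (Fin nl) (Fin nl) ℝ).PosSemidef) ?_
    filter_upwards [hz.ae_hasDerivAt φ fun t => by
      simp only [hfield]
      exact Continuous.continuousAt (by fun_prop)] with t ht
    rw [hfield] at ht
    refine ht.congr_deriv ?_
    funext j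
    simp
  exact tendsto_pi_nhds.1 hlim j

theorem tendsto_follErr_estErr (hH : H.PosDef)
    (hHlmi : (-((matA m)ᵀ * H + H * matA m - (2 : ℝ) • (Cᵀ * C))).PosDef)
    (hL : L = -(H⁻¹ * Cᵀ)) (hz : IsFilippovSolution (closedLoop D Ψ C β K L c₁ c₂) z)
    (hΨ : FactorsThrough Ψ S σ) (hS : S.PosSemidef) (hc₁ : 0 ≤ c₁) :
    Tendsto (fun t => follErr σ (estErr (z t))) atTop (𝓝 0) := by
  set φ : NetState nl nf m →L[ℝ] (Fin nf → Vec m) := (follErr σ).comp estErr with hφ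
  have hfield : ∀ t y, φ (closedLoop D Ψ C β K L c₁ c₂ t y) = fun i =>
      matA m *ᵥ φ y i + L *ᵥ (C *ᵥ φ y i) + L *ᵥ (C *ᵥ ∑ k, (c₁ • S) i k • φ y k) := by
    intro t y
    funext i
    exact follErr_estErr_closedLoop hΨ y i
  refine (hz.locAC.clm_comp φ).tendsto_zero_of_observer hH hHlmi hL (hS.smul hc₁) ?_
  filter_upwards [hz.ae_hasDerivAt φ fun t => by
    simp only [hfield]
    exact Continuous.continuousAt (by fun_prop)] with t ht
  rwa [hfield] at ht

theorem continuous_leaderInput (D : Maneuver nl nf) (β : Fin m → ℝ) (t : ℝ) (j : Fin nl) :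
    Continuous fun z : NetState nl nf m => leaderInput D β t z j := by
  unfold leaderInput
  fun_prop

/-- The leaders track their desired motion states. -/
theorem tendsto_leader {γ : ℕ → ℝ} (hγ : D.HasBoundedDerivs m γ) (hβ : IsHurwitz (matW1 β))
    (hz : IsFilippovSolution (closedLoop D Ψ C β K L c₁ c₂) z) (j : Fin nl)
    (he : Tendsto (fun t => estErr (z t) (Sum.inl j)) atTop (𝓝 0)) :
    Tendsto (fun t => (z t (Sum.inl j)).1 - D.state m (Sum.inl j) t) atTop (𝓝 0) := by
  set φ : NetState nl nf m →L[ℝ] Vec m := (ContinuousLinearMap.fst ℝ (Vec m) (Vec m)).comp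
    (ContinuousLinearMap.proj (R := ℝ) (φ := fun _ : Agent nl nf => Vec m × Vec m)
      (Sum.inl j)) with hφ
  have hφa : ∀ y, φ y = (y (Sum.inl j)).1 := fun _ => rfl
  have hfield : ∀ t y, φ (closedLoop D Ψ C β K L c₁ c₂ t y) =
      matA m *ᵥ (y (Sum.inl j)).1 + matB m *ᵥ leaderInput D β t y j := fun _ _ => rfl
  have hder := hz.ae_hasDerivAt φ fun t => by
    simp only [hfield]
    have hu := continuous_leaderInput D β t j
    exact Continuous.continuousAt (by fun_prop)
  rw [tendsto_pi_nhds]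
  rintro ⟨k, c⟩
  -- The three spatial axes decouple; for a fixed axis `c` the error obeys `W₁`, forced in its last
  -- row by the estimation error.
  suffices h : Tendsto (fun t (k : Fin m) =>
      (z t (Sum.inl j)).1 (k, c) - D.state m (Sum.inl j) t (k, c)) atTop (𝓝 0) from
    tendsto_pi_nhds.1 h k
  refine LocAC.tendsto_zero_of_isHurwitz hβ
    (h := fun t k => if (k : ℕ) + 1 = m then
      ∑ l, β l * estErr (z t) (Sum.inl j) (l, c) else 0) ?_ ?_ ?_
  · refine LocAC.pi fun k => LocAC.sub ((hz.locAC.clm_comp φ).apply (k, c)) ?_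
    exact (Maneuver.locAC_posDeriv hγ j k.2).apply c
  -- At `t = 0` the desired motion has only a one-sided derivative, so this null set is discarded.
  · have hpos : ∀ᵐ t ∂(volume.restrict (Ici (0 : ℝ))), 0 < t := by
      rw [← Measure.restrict_congr_set Ioi_ae_eq_Ici]
      exact ae_restrict_mem measurableSet_Ioi
    filter_upwards [hder, hpos] with t ht htpos
    rw [hasDerivAt_pi]
    intro k
    have h1 := hasDerivAt_pi.1 ht (k, c)
    have h2 : HasDerivAt (fun s => D.state m (Sum.inl j) s (k, c))
        (D.posDeriv (Sum.inl j) (k + 1) t c) t :=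
      hasDerivAt_pi.1 ((Maneuver.hasDerivWithinAt_posDeriv hγ j k.2 htpos.le).hasDerivAt
        (Ici_mem_nhds htpos)) c
    refine (h1.sub h2).congr_deriv ?_
    rw [hfield]
    have hA : ∀ x : Vec m, (matA m *ᵥ x) (k, c) =
        ∑ l : Fin m, if (k : ℕ) + 1 = (l : ℕ) then x (l, c) else 0 := by
      intro x
      simp [matA, Matrix.mulVec, dotProduct, Fintype.sum_prod_type, Matrix.kroneckerMap_apply,
        Matrix.one_apply]
    have hB : ∀ u : Fin 3 → ℝ, (matB m *ᵥ u) (k, c) = if (k : ℕ) + 1 = m then u c else 0 := by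
      intro u
      by_cases hk : (k : ℕ) + 1 = m <;> simp [matB, Matrix.mulVec, dotProduct, hk]
    simp only [Pi.add_apply, hA, hB, leaderInput]
    by_cases hk : (k : ℕ) + 1 = m
    -- In the last row the integrator contributes nothing, and the feedforward `p*⁽ᵐ⁾` cancels the
    -- derivative of `p*⁽ᵐ⁻¹⁾`.
    · have hne : ∀ l : Fin m, ¬ m = (l : ℕ) := fun l hl => by have := l.2; omega
      simp only [hne, hk, if_true, if_false, Finset.sum_const_zero, matW1, Matrix.mulVec,
        dotProduct, Matrix.of_apply, estErr_apply, Pi.sub_apply, mul_sub, Finset.sum_sub_distrib]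
      ring
    · have hlt : (k : ℕ) + 1 < m := by have := k.2; omega
      have hl : ∀ l : Fin m, ((k : ℕ) + 1 = (l : ℕ)) ↔ (⟨k + 1, hlt⟩ : Fin m) = l := fun l => by
        rw [Fin.ext_iff]
      simp [hk, hl, matW1, Matrix.mulVec, dotProduct, Maneuver.state]
  · rw [tendsto_pi_nhds]
    intro k
    by_cases hk : (k : ℕ) + 1 = m
    · simp only [hk, if_true, Pi.zero_apply]
      rw [show (0 : ℝ) = ∑ l, β l * (0 : Vec m) (l, c) by simp]
      exact tendsto_finsetSum _ fun l _ => (tendsto_pi_nhds.1 he (l, c)).const_mul _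
    · simp [hk]

end Trajectories

/-! ### The discontinuous follower controller. -/

/-- The frozen factor `f x₀` vanishes exactly when `x₀` lies where the sign may jump. -/
theorem continuousAt_mul_sign {X : Type*} [TopologicalSpace X] {f : X → ℝ} (hf : Continuous f)
    (x₀ : X) : ContinuousAt (fun x => f x₀ * Real.sign (f x)) x₀ := by
  rcases lt_trichotomy (f x₀) 0 with h | h | h
  · have : (fun x => f x₀ * Real.sign (f x)) =ᶠ[𝓝 x₀] fun _ => f x₀ * (-1) := by
      filter_upwards [hf.continuousAt.eventually (gt_mem_nhds h)] with x hx
      rw [Real.sign_of_neg hx]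
    exact continuousAt_const.congr this.symm
  · simp only [h, zero_mul]
    exact continuousAt_const
  · have : (fun x => f x₀ * Real.sign (f x)) =ᶠ[𝓝 x₀] fun _ => f x₀ * 1 := by
      filter_upwards [hf.continuousAt.eventually (lt_mem_nhds h)] with x hx
      rw [Real.sign_of_pos hx]
    exact continuousAt_const.congr this.symm

theorem mul_sign_eq_abs (x : ℝ) : x * Real.sign x = |x| := by
  rcases lt_trichotomy x 0 with h | h | h
  · rw [Real.sign_of_neg h, abs_of_neg h]; ring
  · simp [h]
  · rw [Real.sign_of_pos h, abs_of_pos h]; ring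

section Followers

variable {nl nf m q : ℕ} {D : Maneuver nl nf} {Ψ : Matrix (Fin nf) (Agent nl nf) ℝ}
    {C : Matrix (Fin q) (Fin m × Fin 3) ℝ} {β : Fin m → ℝ} {K : Matrix (Fin 3) (Fin m × Fin 3) ℝ}
    {L : Matrix (Fin m × Fin 3) (Fin q) ℝ} {c₁ c₂ : ℝ} {R : Matrix (Fin nf) (Fin nf) ℝ}
    {σ : Matrix (Fin nf) (Fin nl) ℝ} {P : Matrix (Fin m × Fin 3) (Fin m × Fin 3) ℝ}
    {z : ℝ → NetState nl nf m}

/-- The pairing of a vector field with the gradient of the Lyapunov function of the follower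
controllers at the state `z₀`. -/
noncomputable def lyapGradient (σ : Matrix (Fin nf) (Fin nl) ℝ) (R : Matrix (Fin nf) (Fin nf) ℝ)
    (P : Matrix (Fin m × Fin 3) (Fin m × Fin 3) ℝ) (z₀ : NetState nl nf m) :
    NetState nl nf m →L[ℝ] ℝ :=
  LinearMap.toContinuousLinearMap
    { toFun := fun v => ∑ i, mixRows R (follErr σ (estimates z₀)) i ⬝ᵥ
        P⁻¹ *ᵥ mixRows R (follErr σ (estimates v)) i
      map_add' := fun v w => by
        simp [Matrix.mulVec_add, dotProduct_add, Finset.sum_add_distrib]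
      map_smul' := fun c v => by
        simp [Matrix.mulVec_smul, dotProduct_smul, Finset.mul_sum] }

theorem lyapGradient_apply (z₀ v : NetState nl nf m) :
    lyapGradient σ R P z₀ v = ∑ i, mixRows R (follErr σ (estimates z₀)) i ⬝ᵥ
        P⁻¹ *ᵥ mixRows R (follErr σ (estimates v)) i := rfl

/-- The discontinuity of the follower controllers is invisible to the gradient of the Lyapunov
function. -/
theorem continuousAt_lyapGradient_closedLoop (hP : P.PosDef) (hK : K = -((matB m)ᵀ * P⁻¹))
    (hΨ : FactorsThrough Ψ (Rᵀ * R) σ) (t : ℝ) (z₀ : NetState nl nf m) :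
    ContinuousAt (fun y => lyapGradient σ R P z₀ (closedLoop D Ψ C β K L c₁ c₂ t y)) z₀ := by
  set s : NetState nl nf m → Fin nf → Fin 3 → ℝ :=
    fun y k => K *ᵥ ∑ j, (Rᵀ * R) k j • follErr σ (estimates y) j with hs
  set g : NetState nl nf m → Fin nf → Vec m := fun y k =>
    matA m *ᵥ follErr σ (estimates y) k +
      matB m *ᵥ (c₁ • s y k + ∑ j, σ k j • leaderInput D β t y j) +
      (L *ᵥ (C *ᵥ follErr σ (estErr y) k) +
        c₁ • (L *ᵥ (C *ᵥ ∑ j, (Rᵀ * R) k j • follErr σ (estErr y) j))) with hg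
  -- The field splits into the continuous part `g` and the signum channel; the gradient, frozen at
  -- `z₀`, weights each signum by its own argument at `z₀`.
  have hsplit : ∀ y, lyapGradient σ R P z₀ (closedLoop D Ψ C β K L c₁ c₂ t y) =
      ∑ i, mixRows R (follErr σ (estimates z₀)) i ⬝ᵥ P⁻¹ *ᵥ mixRows R (g y) i +
        -(c₂ * ∑ k, ∑ a, s z₀ k a * Real.sign (s y k a)) := by
    intro y
    have hy : follErr σ (estimates (closedLoop D Ψ C β K L c₁ c₂ t y)) =
        g y + fun k => matB m *ᵥ (c₂ • sgnVec (s y k)) := by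
      funext k
      rw [follErr_estimates_closedLoop hΨ]
      simp only [hg, hs, Pi.add_apply, Matrix.mulVec_add]
      abel
    have hin := sum_gradient_dot_input hP.isHermitian hK R (follErr σ (estimates z₀))
      (fun k => c₂ • sgnVec (s y k))
    simp only [lyapGradient_apply, hy, map_add, Pi.add_apply, Matrix.mulVec_add, dotProduct_add,
      Finset.sum_add_distrib]
    congr 1
    simp only [mixRows_apply]
    rw [hin]
    simp only [dotProduct_smul, smul_eq_mul, ← Finset.mul_sum]
    rfl
  simp only [hsplit]
  have hsc : Continuous s := by
    rw [hs]
    fun_prop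
  have hgc : Continuous g := by
    have hu := fun j => continuous_leaderInput D β t j
    rw [hg]
    fun_prop
  refine ContinuousAt.add (Continuous.continuousAt (by fun_prop)) ?_
  refine ContinuousAt.neg (ContinuousAt.mul continuousAt_const ?_)
  refine tendsto_finsetSum _ fun k _ => tendsto_finsetSum _ fun a _ => ?_
  exact continuousAt_mul_sign (f := fun y => s y k a) (by fun_prop) z₀

/-- The estimates of the followers track those of the leaders. -/
theorem tendsto_follErr_estimates {γ : ℕ → ℝ} (hP : P.PosDef)
    (hPlmi : (-(matA m * P + P * (matA m)ᵀ - (2 : ℝ) • (matB m * (matB m)ᵀ))).PosDef)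
    (hK : K = -((matB m)ᵀ * P⁻¹)) (hΨ : FactorsThrough Ψ (Rᵀ * R) σ) (hRdet : IsUnit R.det)
    (hR : ∀ x : Fin nf → ℝ, x ⬝ᵥ x ≤ c₁ * ((Rᵀ *ᵥ x) ⬝ᵥ (Rᵀ *ᵥ x)))
    (hγ : D.HasBoundedDerivs m γ) (hm : 1 ≤ m)
    (hc₂ : ∀ i, ∑ j, |σ i j| * γ m ≤ c₂)
    (hz : IsFilippovSolution (closedLoop D Ψ C β K L c₁ c₂) z)
    (he : Tendsto (fun t => follErr σ (estErr (z t))) atTop (𝓝 0))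
    (hlead : ∀ j : Fin nl,
      Tendsto (fun t => (z t (Sum.inl j)).2 - D.state m (Sum.inl j) t) atTop (𝓝 0)) :
    Tendsto (fun t => follErr σ (estimates (z t))) atTop (𝓝 0) := by
  set φ : NetState nl nf m →L[ℝ] (Fin nf → Vec m) :=
    (mixRows R).comp ((follErr σ).comp estimates) with hφ
  have hφa : ∀ y, φ y = mixRows R (follErr σ (estimates y)) := fun _ => rfl
  suffices hlim : Tendsto (fun t => φ (z t)) atTop (𝓝 0) by
    have h1 := ((mixRows R⁻¹).continuous.tendsto' (0 : Fin nf → Vec m) 0 (map_zero _)).comp hlim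
    refine h1.congr fun t => ?_
    exact mixRows_inv hRdet _
  -- Congruence by `P⁻¹` turns the matrix inequality into the decay form acting on `ρ`.
  have hQ : (P⁻¹ * (-(matA m * P + P * (matA m)ᵀ - (2 : ℝ) • (matB m * (matB m)ᵀ))) *
      P⁻¹).PosDef := by
    have h1 := hPlmi.conjTranspose_mul_mul_same (B := P⁻¹)
      (Matrix.mulVec_injective_iff_isUnit.2 hP.inv.isUnit)
    rwa [hP.inv.isHermitian.eq] at h1
  obtain ⟨α, hα, hlow⟩ := posDef_lower_sum (ι := Fin nf) hQ
  -- The vanishing perturbation: leader feedback along the tracking error of the estimates, and the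
  -- estimation errors injected by the observers.
  set η : ℝ → Fin nf → Vec m := fun t k =>
    matB m *ᵥ (∑ j, σ k j • fun c => ∑ l : Fin m, β l *
      ((z t (Sum.inl j)).2 - D.state m (Sum.inl j) t) (l, c)) +
    (L *ᵥ (C *ᵥ follErr σ (estErr (z t)) k) +
      c₁ • (L *ᵥ (C *ᵥ ∑ j, (Rᵀ * R) k j • follErr σ (estErr (z t)) j))) with hη
  have hηlim : Tendsto η atTop (𝓝 0) := by
    have hc : Continuous fun p : (Fin nl → Vec m) × (Fin nf → Vec m) => fun k =>
        matB m *ᵥ (∑ j, σ k j • fun c => ∑ l : Fin m, β l * p.1 j (l, c)) +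
        (L *ᵥ (C *ᵥ p.2 k) + c₁ • (L *ᵥ (C *ᵥ ∑ j, (Rᵀ * R) k j • p.2 j))) := by
      fun_prop
    have h0 := hc.tendsto' (0, 0) 0 (by
      funext k
      have : (fun _ : Fin 3 => (0 : ℝ)) = 0 := rfl
      simp [this])
    have hp : Tendsto (fun t => ((fun j => (z t (Sum.inl j)).2 - D.state m (Sum.inl j) t,
        follErr σ (estErr (z t))) : (Fin nl → Vec m) × (Fin nf → Vec m))) atTop (𝓝 (0, 0)) :=
      Tendsto.prodMk_nhds (tendsto_pi_nhds.2 hlead) he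
    refine (h0.comp hp).congr fun t => ?_
    simp only [hη, Function.comp_def]
  refine (hz.locAC.clm_comp φ).tendsto_zero_of_energy hP.inv (h := fun t => mixRows R (η t)) hα
    (((mixRows R).continuous.tendsto' 0 0 (map_zero _)).comp hηlim) ?_
  filter_upwards [hz.2, ae_restrict_mem measurableSet_Ici] with t ⟨v, hv, hd⟩ ht
  refine ⟨φ v, φ.hasFDerivAt.comp_hasDerivAt t hd, ?_⟩
  -- The velocity `v` may be any element of the Filippov set, yet its pairing with the gradient is
  -- that of the field itself.
  have hgrad := map_eq_of_mem_filippovSet hv (lyapGradient σ R P (z t))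
    (continuousAt_lyapGradient_closedLoop hP hK hΨ t (z t))
  simp only [lyapGradient_apply, ← hφa] at hgrad
  rw [hgrad]
  set s : Fin nf → Fin 3 → ℝ :=
    fun k => K *ᵥ ∑ j, (Rᵀ * R) k j • follErr σ (estimates (z t)) j with hs
  -- Signum plus leader feedforward: by the choice of `c₂` each component has the sign of `s` or is
  -- harmless.
  set w : Fin nf → Fin 3 → ℝ := fun k =>
    c₂ • sgnVec (s k) + ∑ j, σ k j • D.posDeriv (Sum.inl j) m t with hw
  have hsw : ∀ i a, 0 ≤ s i a * w i a := by
    intro i a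
    have h1 : |∑ j, σ i j * D.posDeriv (Sum.inl j) m t a| ≤ c₂ := by
      refine (Finset.abs_sum_le_sum_abs _ _).trans (le_trans ?_ (hc₂ i))
      refine Finset.sum_le_sum fun j _ => ?_
      rw [abs_mul]
      gcongr
      exact (abs_apply_le_norm2 _ a).trans ((hγ j).2 m hm le_rfl t ht)
    have h2 : s i a * w i a = c₂ * |s i a| +
        s i a * ∑ j, σ i j * D.posDeriv (Sum.inl j) m t a := by
      rw [← mul_sign_eq_abs]
      simp only [hw, Pi.add_apply, Pi.smul_apply, smul_eq_mul, sgnVec, Finset.sum_apply]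
      ring
    rw [h2]
    have h3 : |s i a * ∑ j, σ i j * D.posDeriv (Sum.inl j) m t a| ≤ |s i a| * c₂ := by
      rw [abs_mul]
      gcongr
    have h4 := neg_le_of_abs_le h3
    linarith
  have hfield : φ (closedLoop D Ψ C β K L c₁ c₂ t (z t)) =
      mixRows R (fun k => matA m *ᵥ follErr σ (estimates (z t)) k +
        matB m *ᵥ (c₁ • s k + w k)) + mixRows R (η t) := by
    rw [hφa, ← map_add]
    congr 1
    funext k
    rw [follErr_estimates_closedLoop hΨ, Pi.add_apply]
    have hu : ∀ j, leaderInput D β t (z t) j = D.posDeriv (Sum.inl j) m t + fun c =>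
        ∑ l : Fin m, β l * ((z t (Sum.inl j)).2 - D.state m (Sum.inl j) t) (l, c) := by
      intro j
      funext c
      simp only [leaderInput, Pi.add_apply, Pi.sub_apply]
      ring
    simp only [hu, hη, hw, hs, smul_add, Finset.sum_add_distrib, Matrix.mulVec_add]
    abel
  have hlyap := controller_lyapunov hP hK hR (A := matA m) (follErr σ (estimates (z t))) s w
    (fun _ => rfl) hsw
  simp only [← mixRows_apply] at hlyap
  have hl := hlow (φ (z t))
  rw [hfield]
  simp only [Pi.add_apply, Matrix.mulVec_add, dotProduct_add, Finset.sum_add_distrib, mul_add]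
  simp only [hφa] at hl ⊢
  have : 2 * ∑ i, mixRows R (follErr σ (estimates (z t))) i ⬝ᵥ P⁻¹ *ᵥ
      mixRows R (fun k => matA m *ᵥ follErr σ (estimates (z t)) k +
        matB m *ᵥ (c₁ • s k + w k)) i ≤
      -α * ‖mixRows R (follErr σ (estimates (z t)))‖ ^ 2 := by
    simp only [mixRows_apply] at hlyap hl ⊢
    linarith
  simp only [Matrix.mulVec_add] at this
  linarith

end Followers

/-! ### The condition on `c₂` and the main theorem. -/

open scoped Matrix.Norms.L2Operator in
theorem specNorm_nonneg {ι : Type*} [Fintype ι] [DecidableEq ι] (M : Matrix ι ι ℂ) :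
    0 ≤ specNorm M :=
  norm_nonneg M

/-- The gain `c₂` dominates the leader inputs along the desired motion. Since the transients of
the leaders vanish, only `γ_m ≤ γ_u` is needed. -/
theorem sum_abs_sigmaMat_mul_le {nl nf m : ℕ} {Ω : Matrix (Fin nf) (Agent nl nf) ℝ} {ι : Type*}
    [Fintype ι] [DecidableEq ι] {ψ ζ c₂ g : ℝ} {β : Fin m → ℝ} {M : Matrix ι ι ℂ} (hψ : 0 ≤ ψ)
    (hζ : 0 < nl → 0 ≤ ζ) (hg : 0 < nl → 0 ≤ g)
    (hc₂ : nl * sigmaMax Ω * gammaU ψ ζ β M g ≤ c₂) (i : Fin nf) :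
    ∑ j, |sigmaMat Ω i j| * g ≤ c₂ := by
  have hle : ∀ j, |sigmaMat Ω i j| ≤ sigmaMax Ω := fun j =>
    le_ciSup (f := fun ij : Fin nf × Fin nl => |sigmaMat Ω ij.1 ij.2|)
      (finite_range _).bddAbove (i, j)
  -- The signs of `ζ` and `g` are known only if a leader exists; without leaders the claim is `0 ≤
  -- c₂`.
  rcases Nat.eq_zero_or_pos nl with rfl | hnl
  · simpa using hc₂
  have hσ : 0 ≤ sigmaMax Ω := (abs_nonneg _).trans (hle ⟨0, hnl⟩)
  have hgU : g ≤ gammaU ψ ζ β M g := by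
    have := norm2_nonneg β
    have := specNorm_nonneg M
    have := specNorm_nonneg M⁻¹
    have := hζ hnl
    have : 0 ≤ 4 * ψ * ζ * norm2 β * specNorm M * specNorm M⁻¹ := by positivity
    unfold gammaU
    linarith
  have hg0 := hg hnl
  calc ∑ j, |sigmaMat Ω i j| * g ≤ ∑ _j : Fin nl, sigmaMax Ω * g := by
        gcongr with j
        exact hle j
    _ = nl * sigmaMax Ω * g := by simp [mul_assoc]
    _ ≤ nl * sigmaMax Ω * gammaU ψ ζ β M g := by gcongr
    _ ≤ c₂ := hc₂

theorem theorem3 {nl nf m q : ℕ} (hm : 1 ≤ m)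
    -- nominal formation, displacement parameters, nonsingular `Ω_ff`
    (F : NominalFormation nl nf) (w : Fin nf → Agent nl nf → ℝ)
    (hw : F.IsDisplacementParam w)
    (Ω : Matrix (Fin nf) (Agent nl nf) ℝ) (hΩ : Ω = F.followerMatrix w)
    (hloc : IsLocalizable Ω)
    -- desired formation
    (D : Maneuver nl nf) (hD : D.IsAdmissible Ω)
    (γ : ℕ → ℝ) (hγ : D.HasBoundedDerivs m γ)
    -- gains
    (C : Matrix (Fin q) (Fin m × Fin 3) ℝ)
    (β : Fin m → ℝ) (hβ : IsHurwitz (matW1 β))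
    (P : Matrix (Fin m × Fin 3) (Fin m × Fin 3) ℝ) (hP : P.PosDef)
    (hPlmi : (-(matA m * P + P * (matA m)ᵀ - (2 : ℝ) • (matB m * (matB m)ᵀ))).PosDef)
    (K : Matrix (Fin 3) (Fin m × Fin 3) ℝ) (hK : K = -((matB m)ᵀ * P⁻¹))
    (H : Matrix (Fin m × Fin 3) (Fin m × Fin 3) ℝ) (hH : H.PosDef)
    (hHlmi : (-((matA m)ᵀ * H + H * matA m - (2 : ℝ) • (Cᵀ * C))).PosDef)
    (L : Matrix (Fin m × Fin 3) (Fin q) ℝ) (hL : L = -(H⁻¹ * Cᵀ))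
    -- an arbitrary bounded set of initial leader states, and a bound on the initial errors
    (X : Set (Fin nl → Vec m)) (hX : Bornology.IsBounded X)
    (ζ : ℝ) (hζ : ∀ x ∈ X, ∀ i, norm2 (x i - D.state m (Sum.inl i) 0) ≤ ζ)
    -- the constant `γ_u`
    (J M : Matrix ((Fin m × Fin 3) ⊕ (Fin m × Fin 3)) ((Fin m × Fin 3) ⊕ (Fin m × Fin 3)) ℂ)
    (hJ : IsJordanForm J) (hM : IsUnit M.det) (hW : cplx (matW β C L) = M * J * M⁻¹)
    (ψ : ℝ) (hψ : ψ = psiExplicit β C L ∨ BoundsExp J ψ)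
    (c₁ c₂ : ℝ) (hc₁ : max 1 (1 / lambdaMin ((blockFF Ω)ᵀ * blockFF Ω)) < c₁)
    (hc₂pos : 0 < c₂) (hc₂ : nl * sigmaMax Ω * gammaU ψ ζ β M (γ m) ≤ c₂)
    -- either of the two follower controllers
    (Ψ : Matrix (Fin nf) (Agent nl nf) ℝ) (hΨ : Ψ = barMatrix Ω ∨ Ψ = hatMatrix Ω)
    -- an arbitrary closed-loop trajectory
    (z : ℝ → NetState nl nf m)
    (hz : IsFilippovSolution (closedLoop D Ψ C β K L c₁ c₂) z)
    (hx0 : (fun i : Fin nl => (z 0 (Sum.inl i)).1) ∈ X)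
    (hη0 : ∀ i : Fin nl, norm2 ((z 0 (Sum.inl i)).2 - (z 0 (Sum.inl i)).1) ≤ ζ) :
    -- leaders and followers track their desired motion states
    (∀ i : Agent nl nf, Tendsto (fun t => (z t i).1 - D.state m i t) atTop (𝓝 0)) ∧
    -- the follower errors vanish, for the motion states and for the estimates
    (∀ i : Fin nf, Tendsto
      (fun t => z t (Sum.inr i) + ∑ j : Fin nl, sigmaMat Ω i j • z t (Sum.inl j))
      atTop (𝓝 0)) := by
  have hrow : ∀ i, ∑ j, Ω i j = 0 := fun i => by rw [hΩ, followerMatrix_row_sum]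
  obtain ⟨R, hRdet, hfac, hR⟩ := exists_factorsThrough hloc hrow hc₁ hΨ
  have hc₁0 : 0 ≤ c₁ := zero_le_one.trans ((le_max_left _ _).trans hc₁.le)
  have hS : (Rᵀ * R).PosSemidef := by
    simpa [Matrix.conjTranspose_eq_transpose_of_trivial] using
      Matrix.posSemidef_conjTranspose_mul_self R
  have hψ0 : 0 ≤ ψ := by
    rcases hψ with h | h
    · rw [h]
      exact Real.sqrt_nonneg _
    · exact (specNorm_nonneg _).trans (h 1 one_pos)
  have hgain := sum_abs_sigmaMat_mul_le (Ω := Ω) hψ0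
    (fun h => (norm2_nonneg _).trans (hη0 ⟨0, h⟩))
    (fun h => (norm2_nonneg _).trans ((hγ ⟨0, h⟩).2 m hm le_rfl 0 le_rfl)) hc₂
  have hel := tendsto_estErr_leader hH hHlmi hL hz
  have hxl := fun j => tendsto_leader hγ hβ hz j (hel j)
  have hηl : ∀ j : Fin nl,
      Tendsto (fun t => (z t (Sum.inl j)).2 - D.state m (Sum.inl j) t) atTop (𝓝 0) := by
    intro j
    have h := (hel j).add (hxl j)
    rw [add_zero] at h
    refine h.congr fun t => ?_
    simp
  have hef := tendsto_follErr_estErr hH hHlmi hL hz hfac hS hc₁0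
  have hηf := tendsto_follErr_estimates hP hPlmi hK hfac hRdet hR hγ hm hgain hz hef hηl
  have hxf : ∀ i : Fin nf, Tendsto (fun t => (z t (Sum.inr i)).1 +
      ∑ j, sigmaMat Ω i j • (z t (Sum.inl j)).1) atTop (𝓝 0) := by
    intro i
    -- States are estimates minus estimation errors, and `follErr` is linear.
    have h := (tendsto_pi_nhds.1 hηf i).sub (tendsto_pi_nhds.1 hef i)
    rw [Pi.zero_apply, sub_zero] at h
    refine h.congr fun t => ?_
    simp only [follErr_apply, estimates_apply, estErr_apply, smul_sub, Finset.sum_sub_distrib]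
    abel
  refine ⟨?_, fun i => ?_⟩
  · rintro (j | i)
    · exact hxl j
    -- Subtracting the leader tracking errors, weighted by `σ`, leaves the follower tracking error,
    -- because the desired states obey the same relation.
    · have h := (hxf i).sub (tendsto_finsetSum Finset.univ fun j _ =>
        (hxl j).const_smul (sigmaMat Ω i j))
      simp only [smul_zero, Finset.sum_const_zero, sub_zero] at h
      refine h.congr' ?_
      filter_upwards [eventually_ge_atTop (0 : ℝ)] with t ht
      have hst : D.state m (Sum.inr i) t =
          -∑ j, sigmaMat Ω i j • D.state m (Sum.inl j) t := by
        funext ⟨k, c⟩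
        have := congrFun (Maneuver.posDeriv_follower hloc hrow hD hγ i k.2.le ht) c
        simpa [Maneuver.state, Finset.sum_apply] using this
      rw [hst]
      simp only [smul_sub, Finset.sum_sub_distrib]
      abel
  · have h := (hxf i).prodMk_nhds (tendsto_pi_nhds.1 hηf i)
    refine h.congr fun t => ?_
    rw [follErr_apply]
    ext1 <;> simp [Prod.fst_sum, Prod.snd_sum]
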